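/- Let $d\ge 1$, $\lambda\ge 1$, $\sigma>0$, $\delta\in(0,1)$. In each round $t=1,2,\dots$ of a standard linear contextual bandit with $K$ arms, (adaptively generated, random) contexts $x_{t,1},\dots,x_{t,K}\in\mathbb{R}^d$ with $\|x_{t,a}\|_2\le 1$ are revealed, the learner selects an arm $a_t$, and with $x_t:=x_{t,a_t}$ it receives the reward $r_t=\theta_*^\top x_t+\varepsilon_t$, where $\theta_*\in\mathbb{R}^d$ is unknown, $\|\theta_*\|_2\le 1$, $\mathbb{E}[\varepsilon_t\mid x_t]=0$, and the noise is conditionally $\sigma$-sub-Gaussian: $\mathbb{E}[\exp(\rho\varepsilon_t)\mid\mathcal{F}_t]\le\exp(\rho^2\sigma^2/2)$ almost surely for all $\rho\in\mathbb{R}$, with $\mathcal{F}_t$ the $\sigma$-algebra generated by $x_1,a_1,r_1,\dots,x_{t-1},a_{t-1},r_{t-1},x_t$. (The normalization in common use is $\sigma=1$.) The cumulative pseudo-regret is $$\mathcal{R}(T)=\sum_{t=1}^{T}\Big(\max_{1\le a\le K}\theta_*^\top x_{t,a}-\theta_*^\top x_t\Big).$$ Given a positive nondecreasing bias sequence $\alpha(1)\le\alpha(2)\le\cdots$,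 put $V_t=\lambda I+\sum_{s<t}x_sx_s^\top$ and $\widehat\theta_t=V_t^{-1}\sum_{s<t}r_sx_s$. The LinRBMLE policy selects in every round an arm $$a_t\in\operatorname*{arg\,max}_{1\le a\le K}\Big\{\widehat\theta_t^\top x_{t,a}+\tfrac12\alpha(t)\,x_{t,a}^\top V_t^{-1}x_{t,a}\Big\}.$$ Let $$G_0(T,\delta)=\sigma\sqrt{d\log\frac{\lambda+T}{\lambda}+\max\{d,2\}\log\frac1\delta}+\sqrt\lambda,\qquad G_1(T)=\sqrt{2d\log\frac{d\lambda+T}{d}},$$ so that $G_0(T,\delta)=\sigma\sqrt{d\log\frac{\lambda+T}{\lambda\delta}}+\sqrt\lambda$ when $d\ge2$. (1) If the LinRBMLE policy is used, then with probability at least $1-\delta$, for all $T\ge1$, $$\mathcal{R}(T)\le G_0(T,\delta)^2\sum_{t=1}^{T}\frac1{2\alpha(t)}+\sqrt T\,G_0(T,\delta)\,G_1(T)+\tfrac12\alpha(T)\,G_1(T)^2,$$ and, on the same event, for all $T\ge 3d$ the same inequality also holds with $G_1(T)$ replaced by $\sqrt{2d\log\frac{\lambda+T}{d}}$. (2) Consequently,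 for $\alpha(t)=\sqrt t$ the regret is $O(\sqrt T\log T)$: there is a constant $C$ depending only on $d,\lambda,\sigma,\delta$ such that, for every such bandit, with probability at least $1-\delta$, $\mathcal{R}(T)\le C\sqrt T\log T$ for all $T\ge2$. -/

import Mathlib

open MeasureTheory

noncomputable section

/-- A trajectory of a contextual bandit with `K` arms and `d`-dimensional contexts. Rounds are
numbered `1, 2, 3, …` (the values at `0` are never used): `ctx t a` is the context vector of arm `a`
in round `t`, `act t` the arm selected in round `t`, and `rew t` the reward obtained in round `t`. -/
structure BanditRun (d K : ℕ) (Ω : Type*) where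
  ctx : ℕ → Fin K → Ω → EuclideanSpace ℝ (Fin d)
  act : ℕ → Ω → Fin K
  rew : ℕ → Ω → ℝ

namespace BanditRun

variable {d K : ℕ} {Ω : Type*}

/-- The context `x_t` of the selected arm. -/
def chosen (B : BanditRun d K Ω) (t : ℕ) (ω : Ω) : EuclideanSpace ℝ (Fin d) :=
  B.ctx t (B.act t ω) ω

/-- The noise `ε_t = r_t - θᵀ x_t`. -/
def noise (B : BanditRun d K Ω) (θ : EuclideanSpace ℝ (Fin d)) (t : ℕ) (ω : Ω) : ℝ :=
  B.rew t ω - inner ℝ θ (B.chosen t ω)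

/-- The σ-algebra `F_t` generated by `x_1, a_1, r_1, …, x_{t-1}, a_{t-1}, r_{t-1}, x_t`. -/
@[reducible] def history (B : BanditRun d K Ω) (t : ℕ) : MeasurableSpace Ω :=
  (⨆ s ∈ Set.Icc 1 t, MeasurableSpace.comap (B.chosen s) inferInstance) ⊔
  (⨆ s ∈ Set.Ico 1 t, MeasurableSpace.comap (B.act s) inferInstance) ⊔
  (⨆ s ∈ Set.Ico 1 t, MeasurableSpace.comap (B.rew s) inferInstance)

/-- The regularized Gram matrix `V_t = λ I + ∑_{s < t} x_s x_sᵀ`. -/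
def gram (B : BanditRun d K Ω) (lam : ℝ) (t : ℕ) (ω : Ω) : Matrix (Fin d) (Fin d) ℝ :=
  lam • (1 : Matrix (Fin d) (Fin d) ℝ) +
    ∑ s ∈ Finset.Ico 1 t, Matrix.vecMulVec (B.chosen s ω).ofLp (B.chosen s ω).ofLp

/-- The regularized least squares estimate `θ̂_t = V_t⁻¹ ∑_{s < t} r_s x_s`. -/
def estimate (B : BanditRun d K Ω) (lam : ℝ) (t : ℕ) (ω : Ω) : Fin d → ℝ :=
  Matrix.mulVec (B.gram lam t ω)⁻¹
    (∑ s ∈ Finset.Ico 1 t, B.rew s ω • (B.chosen s ω).ofLp)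

/-- The LinRBMLE index `θ̂_tᵀ x_{t,a} + (α(t) / 2) x_{t,a}ᵀ V_t⁻¹ x_{t,a}` of arm `a`. -/
def index (B : BanditRun d K Ω) (lam : ℝ) (α : ℕ → ℝ) (t : ℕ) (a : Fin K) (ω : Ω) : ℝ :=
  dotProduct (B.estimate lam t ω) (B.ctx t a ω).ofLp +
    1 / 2 * α t *
      dotProduct (B.ctx t a ω).ofLp (Matrix.mulVec (B.gram lam t ω)⁻¹ (B.ctx t a ω).ofLp)

/-- In every round the selected arm maximizes the LinRBMLE index (ties are broken arbitrarily). -/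
def FollowsLinRBMLE (B : BanditRun d K Ω) (lam : ℝ) (α : ℕ → ℝ) : Prop :=
  ∀ t, 1 ≤ t → ∀ ω a, B.index lam α t a ω ≤ B.index lam α t (B.act t ω) ω

/-- The cumulative pseudo-regret `R(T) = ∑_{t=1}^T (max_a θᵀ x_{t,a} - θᵀ x_t)`. -/
def regret (B : BanditRun d K Ω) (θ : EuclideanSpace ℝ (Fin d)) (T : ℕ) (ω : Ω) : ℝ :=
  ∑ t ∈ Finset.Icc 1 T, ((⨆ a : Fin K, inner ℝ θ (B.ctx t a ω)) - inner ℝ θ (B.chosen t ω))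

/-- The standard linear bandit model with true parameter `θ` and conditionally `σ`-sub-Gaussian
noise. The contexts may be adaptive: nothing is assumed about how they depend on the past. -/
structure IsStandardLinear [MeasurableSpace Ω] (B : BanditRun d K Ω) (P : Measure Ω)
    (θ : EuclideanSpace ℝ (Fin d)) (σ : ℝ) : Prop where
  measurable_ctx : ∀ t, 1 ≤ t → ∀ a, Measurable (B.ctx t a)
  measurable_act : ∀ t, 1 ≤ t → Measurable (B.act t)
  measurable_rew : ∀ t, 1 ≤ t → Measurable (B.rew t)
  norm_ctx_le : ∀ t, 1 ≤ t → ∀ a ω, ‖B.ctx t a ω‖ ≤ 1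
  norm_param_le : ‖θ‖ ≤ 1
  integrable_noise : ∀ t, 1 ≤ t → Integrable (B.noise θ t) P
  condExp_noise : ∀ t, 1 ≤ t →
    P[B.noise θ t | MeasurableSpace.comap (B.chosen t) inferInstance] =ᵐ[P] 0
  integrable_exp_noise : ∀ t, 1 ≤ t → ∀ ρ : ℝ,
    Integrable (fun ω => Real.exp (ρ * B.noise θ t ω)) P
  subgaussian_noise : ∀ t, 1 ≤ t → ∀ ρ : ℝ,
    P[fun ω => Real.exp (ρ * B.noise θ t ω) | B.history t]
      ≤ᵐ[P] fun _ => Real.exp (ρ ^ 2 * σ ^ 2 / 2)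

end BanditRun

/-- `G₀(T, δ)`. For `d ≥ 2` it equals `σ √(d log ((λ + T) / (λ δ))) + √λ`; for `d = 1` the factor of
`log (1 / δ)` is `2`. -/
def G0 (d : ℕ) (lam σ δ : ℝ) (T : ℕ) : ℝ :=
  σ * Real.sqrt (d * Real.log ((lam + T) / lam) + (max d 2 : ℕ) * Real.log (1 / δ)) + Real.sqrt lam

/-- `√(2 d log ((d λ + T) / d))`. -/
def G1 (d : ℕ) (lam : ℝ) (T : ℕ) : ℝ :=
  Real.sqrt (2 * d * Real.log ((d * lam + T) / d))

/-- `√(2 d log ((λ + T) / d))`. -/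
def G1' (d : ℕ) (lam : ℝ) (T : ℕ) : ℝ :=
  Real.sqrt (2 * d * Real.log ((lam + T) / d))

/-- `g₀² ∑_{t=1}^T 1 / (2 α(t)) + √T g₀ g₁ + (1/2) α(T) g₁²`. -/
def regretBound (α : ℕ → ℝ) (g₀ g₁ : ℝ) (T : ℕ) : ℝ :=
  g₀ ^ 2 * ∑ t ∈ Finset.Icc 1 T, 1 / (2 * α t) + Real.sqrt T * g₀ * g₁ + 1 / 2 * α T * g₁ ^ 2

/-- For `d ≥ 2`, `G0` has the closed form in its description. -/
theorem G0_eq {d : ℕ} (hd : 2 ≤ d) {lam σ δ : ℝ} (hlam : 0 < lam) (hδ : 0 < δ) (T : ℕ) :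
    G0 d lam σ δ T = σ * Real.sqrt (d * Real.log ((lam + T) / (lam * δ))) + Real.sqrt lam := by
  have h1 : (lam + T) / lam ≠ 0 := by positivity
  have h2 : (1 / δ) ≠ 0 := by positivity
  have h3 : (lam + T) / (lam * δ) = (lam + T) / lam * (1 / δ) := by field_simp
  rw [G0, max_eq_left hd, h3, Real.log_mul h1 h2, mul_add]

end

/-! Write x_t for the chosen context, S_t = ∑_{s<t} ε_s x_s, and w_t = x_tᵀ V_t⁻¹ x_t. The argument
separates one probabilistic event from a pathwise estimate on it.

Probability: M_t = √(λ^d / det V_t) exp(S_tᵀ V_t⁻¹ S_t / (2σ²)) is a nonnegative supermartingale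
with M_1 = 1. By the determinant lemma and Sherman-Morrison (`expMixture_succ`), M_{t+1} / M_t is
the average of exp(ρ ε_t - ρ²σ²/2) over a one-dimensional Gaussian ρ whose mean and variance are
known before ε_t, so sub-Gaussianity bounds its conditional mean by 1 and no d-dimensional integral
is needed. Ville's inequality gives M_t < 1/δ for all t at once, outside an event of probability at
most δ. Taking logarithms and bounding det V_t by AM-GM gives √(S_tᵀ V_t⁻¹ S_t) + √λ ≤ G₀
(`sqrt_noiseSum_add_sqrt_le_G0`).

Pathwise: with β = G₀, every arm z satisfies |(θ̂_t - θ)ᵀ z| ≤ β √q, where q = zᵀ V_t⁻¹ z. The index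
bonus is quadratic in √q, and β √q - α q / 2 ≤ β² / (2α) for every q, so no control of the best
arm's width is needed. The regret of round t is then at most β² / (2α(t)) + β √w_t + α(t) w_t / 2.
Summing uses Cauchy-Schwarz, the monotonicity of α, and the elliptical potential lemma, which bounds
∑ w_t through the growth of log det V_t (`regret_le_regretBound`). -/

noncomputable section

open ProbabilityTheory

/-! ### Linear algebra: rank-one updates, inverse forms and determinants. -/

namespace Matrix

variable {n : Type*} [Fintype n]

theorem IsHermitian.dotProduct_mulVec_comm {A : Matrix n n ℝ} (hA : A.IsHermitian) (u v : n → ℝ) :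
    u ⬝ᵥ A *ᵥ v = v ⬝ᵥ A *ᵥ u := by
  have h : Aᵀ = A := by simpa [IsHermitian] using hA
  rw [dotProduct_mulVec, ← mulVec_transpose, h, dotProduct_comm]

/-- The Cauchy-Schwarz inequality for a positive semidefinite quadratic form. -/
theorem PosSemidef.sq_dotProduct_mulVec_le {A : Matrix n n ℝ} (hA : A.PosSemidef) (u v : n → ℝ) :
    (u ⬝ᵥ A *ᵥ v) ^ 2 ≤ (u ⬝ᵥ A *ᵥ u) * (v ⬝ᵥ A *ᵥ v) := by
  have key : ∀ s : ℝ, 0 ≤ (v ⬝ᵥ A *ᵥ v) * (s * s) + (2 * (u ⬝ᵥ A *ᵥ v)) * s + u ⬝ᵥ A *ᵥ u := by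
    intro s
    have h : 0 ≤ (u + s • v) ⬝ᵥ A *ᵥ (u + s • v) := by
      simpa using hA.dotProduct_mulVec_nonneg (u + s • v)
    have e := hA.isHermitian.dotProduct_mulVec_comm v u
    simp only [mulVec_add, mulVec_smul, dotProduct_add, add_dotProduct, dotProduct_smul,
      smul_dotProduct, smul_eq_mul] at h
    rw [e] at h
    linarith
  have := discrim_le_zero key
  rw [discrim] at this
  linarith

variable [DecidableEq n]

theorem det_add_vecMulVec_self {A : Matrix n n ℝ} (hA : IsUnit A.det) (x : n → ℝ) :
    (A + vecMulVec x x).det = A.det * (1 + x ⬝ᵥ A⁻¹ *ᵥ x) := by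
  rw [vecMulVec_eq Unit, det_add_replicateCol_mul_replicateRow hA]
  congr 1
  rw [det_unique]
  simp [mul_apply, replicateRow, replicateCol, dotProduct,
    mulVec, Finset.mul_sum, Finset.sum_mul]
  rw [Finset.sum_comm]
  simp [mul_assoc]

/-- The Sherman-Morrison formula, applied to a vector. -/
theorem inv_add_vecMulVec_self_mulVec {A : Matrix n n ℝ} (hA : IsUnit A.det) {x : n → ℝ}
    (hx : 1 + x ⬝ᵥ A⁻¹ *ᵥ x ≠ 0) (z : n → ℝ) :
    (A + vecMulVec x x)⁻¹ *ᵥ z =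
      A⁻¹ *ᵥ z - ((x ⬝ᵥ A⁻¹ *ᵥ z) / (1 + x ⬝ᵥ A⁻¹ *ᵥ x)) • A⁻¹ *ᵥ x := by
  have hB : IsUnit (A + vecMulVec x x).det := by
    rw [det_add_vecMulVec_self hA]
    exact hA.mul hx.isUnit
  have hv : ∀ y : n → ℝ, A *ᵥ A⁻¹ *ᵥ y = y := fun y => by
    rw [mulVec_mulVec, mul_nonsing_inv _ hA, one_mulVec]
  have hr : ∀ y : n → ℝ, vecMulVec x x *ᵥ y = (x ⬝ᵥ y) • x := fun y => by
    ext i; simp [vecMulVec_mulVec, mul_comm]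
  -- The claimed vector solves the linear system; invertibility then identifies it with the inverse
  -- applied to `z`.
  have key : (A + vecMulVec x x) *ᵥ
      (A⁻¹ *ᵥ z - ((x ⬝ᵥ A⁻¹ *ᵥ z) / (1 + x ⬝ᵥ A⁻¹ *ᵥ x)) • A⁻¹ *ᵥ x) = z := by
    rw [add_mulVec, mulVec_sub, mulVec_smul, hv, hv, hr, dotProduct_sub, dotProduct_smul]
    ext i
    simp only [Pi.add_apply, Pi.sub_apply, Pi.smul_apply, smul_eq_mul]
    field_simp
    ring
  conv_lhs => rw [← key]
  rw [mulVec_mulVec, nonsing_inv_mul _ hB, one_mulVec]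

theorem PosDef.dotProduct_inv_mulVec_nonneg {A : Matrix n n ℝ} (hA : A.PosDef) (x : n → ℝ) :
    0 ≤ x ⬝ᵥ A⁻¹ *ᵥ x := by
  simpa using hA.inv.posSemidef.dotProduct_mulVec_nonneg x

/-- How the squared norm `sᵀ A⁻¹ s` changes under a simultaneous rank-one update of `A` and shift
of `s`. -/
theorem PosDef.dotProduct_inv_add_vecMulVec_self_mulVec {A : Matrix n n ℝ} (hA : A.PosDef)
    (x s : n → ℝ) (e : ℝ) :
    (s + e • x) ⬝ᵥ (A + vecMulVec x x)⁻¹ *ᵥ (s + e • x) =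
      s ⬝ᵥ A⁻¹ *ᵥ s + (2 * e * (x ⬝ᵥ A⁻¹ *ᵥ s) + e ^ 2 * (x ⬝ᵥ A⁻¹ *ᵥ x) - (x ⬝ᵥ A⁻¹ *ᵥ s) ^ 2) /
        (1 + x ⬝ᵥ A⁻¹ *ᵥ x) := by
  have hw := hA.dotProduct_inv_mulVec_nonneg x
  have hw' : 1 + x ⬝ᵥ A⁻¹ *ᵥ x ≠ 0 := by positivity
  have hc := hA.inv.isHermitian.dotProduct_mulVec_comm s x
  rw [inv_add_vecMulVec_self_mulVec hA.det_pos.ne'.isUnit hw']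
  simp only [mulVec_add, mulVec_smul, dotProduct_add, add_dotProduct, dotProduct_smul,
      smul_dotProduct, smul_eq_mul, dotProduct_sub, hc]
  field_simp
  ring

/-- With y = A⁻¹ x, the hypothesis gives c |y|² ≤ x·y; expanding 0 ≤ |x - c y|² and inserting this
leaves c (x·y) ≤ |x|². No spectral decomposition is needed. -/
theorem PosDef.dotProduct_inv_mulVec_le {A : Matrix n n ℝ} (hA : A.PosDef) {c : ℝ} (hc : 0 < c)
    (h : ∀ y : n → ℝ, c * (y ⬝ᵥ y) ≤ y ⬝ᵥ A *ᵥ y) (x : n → ℝ) :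
    x ⬝ᵥ A⁻¹ *ᵥ x ≤ (x ⬝ᵥ x) / c := by
  set y := A⁻¹ *ᵥ x with hy
  have h1 : A *ᵥ y = x := by
    rw [hy, mulVec_mulVec, mul_nonsing_inv _ hA.det_pos.ne'.isUnit, one_mulVec]
  have h2 := h y
  rw [h1, dotProduct_comm y x] at h2
  have h3 : 0 ≤ (x - c • y) ⬝ᵥ (x - c • y) := by
    simpa using dotProduct_star_self_nonneg (x - c • y)
  simp only [dotProduct_sub, sub_dotProduct, dotProduct_smul, smul_dotProduct, smul_eq_mul,
    dotProduct_comm y x] at h3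
  rw [le_div_iff₀ hc]
  nlinarith

/-- AM-GM for the eigenvalues, whose product is the determinant and whose sum is the trace. -/
theorem PosDef.det_le_trace_div_card_pow [Nonempty n] {A : Matrix n n ℝ} (hA : A.PosDef) :
    A.det ≤ (A.trace / Fintype.card n) ^ Fintype.card n := by
  have hn : (0 : ℝ) < Fintype.card n := by exact_mod_cast Fintype.card_pos
  have hpos : ∀ i ∈ Finset.univ, 0 ≤ hA.isHermitian.eigenvalues i :=
    fun i _ => (hA.eigenvalues_pos i).le
  have h := Real.geom_mean_le_arith_mean Finset.univ (fun _ => (1 : ℝ)) hA.isHermitian.eigenvalues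
    (by simp) (by simpa using hn) hpos
  have hd := hA.isHermitian.det_eq_prod_eigenvalues
  have ht := hA.isHermitian.trace_eq_sum_eigenvalues
  simp only [RCLike.ofReal_real_eq_id, id_eq] at hd ht
  simp only [Real.rpow_one, Finset.sum_const, Finset.card_univ, nsmul_eq_mul, mul_one, one_mul,
    ← hd, ← ht] at h
  calc A.det = (A.det ^ ((Fintype.card n : ℝ)⁻¹)) ^ Fintype.card n := by
        rw [Real.rpow_inv_natCast_pow hA.det_pos.le Fintype.card_ne_zero]
    _ ≤ _ := by gcongr; exact Real.rpow_nonneg hA.det_pos.le _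

end Matrix

/-! ### Scalar inequalities and a Gaussian integral. -/

/-- Bernoulli's inequality 2^w ≤ 1 + w for exponents in [0, 1]. The factor log 2, rather than 1/2,
leaves the slack needed for `G1'`. -/
theorem Real.mul_log_two_le_log_one_add {w : ℝ} (h0 : 0 ≤ w) (h1 : w ≤ 1) :
    w * Real.log 2 ≤ Real.log (1 + w) := by
  rw [← Real.log_rpow two_pos]
  refine Real.log_le_log (by positivity) ?_
  have := rpow_one_add_le_one_add_mul_self (s := 1) (by norm_num) h0 h1
  norm_num at this
  linarith

/-- From (1 + u)³ ≤ u⁴ for u ≥ 3, together with 4/3 ≤ 2 log 2. This is the source of the restriction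
T ≥ 3d, with u = T/d. -/
theorem Real.log_one_add_le_two_mul_log_two_mul_log {u : ℝ} (hu : 3 ≤ u) :
    Real.log (1 + u) ≤ 2 * Real.log 2 * Real.log u := by
  have h1 : Real.log ((1 + u) ^ 3) ≤ Real.log (u ^ 4) := by
    refine Real.log_le_log (by positivity) ?_
    nlinarith [mul_nonneg (sub_nonneg.2 hu) (sq_nonneg u),
      mul_nonneg (sub_nonneg.2 hu) (pow_nonneg (by linarith : 0 ≤ u) 3)]
  rw [Real.log_pow, Real.log_pow] at h1
  push_cast at h1
  nlinarith [Real.log_two_gt_d9, Real.log_nonneg (by linarith : 1 ≤ u)]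

/-- A Gaussian mixture, in the parameter `ρ = m / σ² + √w / σ · g`, of the exponentials
`exp (ρ e - ρ² σ² / 2)`. -/
theorem lintegral_gaussianReal_exp_linear_sub_sq {σ : ℝ} (hσ : 0 < σ) {w : ℝ} (hw : 0 ≤ w)
    (m e : ℝ) :
    ∫⁻ g, ENNReal.ofReal (Real.exp ((m / σ ^ 2 + √w / σ * g) * e
        - (m / σ ^ 2 + √w / σ * g) ^ 2 * σ ^ 2 / 2)) ∂(gaussianReal 0 1) =
      ENNReal.ofReal ((√(1 + w))⁻¹ *
        Real.exp ((2 * e * m + e ^ 2 * w - m ^ 2) / (1 + w) / (2 * σ ^ 2))) := by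
  have h1w : 0 < 1 + w := by positivity
  obtain ⟨v, hvc⟩ : ∃ v : NNReal, (v : ℝ) = (1 + w)⁻¹ := ⟨⟨(1 + w)⁻¹, by positivity⟩, rfl⟩
  have hv0 : v ≠ 0 := by
    rw [← NNReal.coe_ne_zero, hvc]
    positivity
  rw [gaussianReal_of_var_ne_zero _ one_ne_zero,
    lintegral_withDensity_eq_lintegral_mul _ (measurable_gaussianPDF _ _) (by fun_prop)]
  -- Completing the square in g turns the integrand into a constant times the density of variance
  -- 1/(1 + w) and mean (√w/σ)(e - m)/(1 + w). Writing the factor 1 as the mass of that density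
  -- reduces the claim to a pointwise identity.
  rw [← mul_one (ENNReal.ofReal (_ * _)), ← lintegral_gaussianPDF_eq_one
    ((√w / σ * (e - m)) / (1 + w)) hv0, ← lintegral_const_mul _ (measurable_gaussianPDF _ _)]
  refine lintegral_congr fun g => ?_
  simp only [Pi.mul_apply, gaussianPDF, gaussianPDFReal]
  rw [← ENNReal.ofReal_mul (by positivity), ← ENNReal.ofReal_mul (by positivity)]
  congr 1
  rw [hvc, NNReal.coe_one, mul_one, ← div_eq_mul_inv (2 * Real.pi), Real.sqrt_div (by positivity),
    inv_div]
  have hsw : √w ^ 2 = w := Real.sq_sqrt hw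
  have hs : √(1 + w) ≠ 0 := by positivity
  have hp : √(2 * Real.pi) ≠ 0 := by positivity
  have hexp : -(g - 0) ^ 2 / 2 + ((m / σ ^ 2 + √w / σ * g) * e
        - (m / σ ^ 2 + √w / σ * g) ^ 2 * σ ^ 2 / 2) =
      (2 * e * m + e ^ 2 * w - m ^ 2) / (1 + w) / (2 * σ ^ 2) +
        -(g - (√w / σ * (e - m)) / (1 + w)) ^ 2 / (2 * (1 + w)⁻¹) := by
    obtain ⟨r, hr⟩ : ∃ r, r = √w := ⟨_, rfl⟩
    rw [← hr] at hsw ⊢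
    subst hsw
    field_simp
    ring
  calc _ = (√(2 * Real.pi))⁻¹ * (Real.exp (-(g - 0) ^ 2 / 2) *
        Real.exp ((m / σ ^ 2 + √w / σ * g) * e
        - (m / σ ^ 2 + √w / σ * g) ^ 2 * σ ^ 2 / 2)) := by
        rw [mul_assoc, mul_one]
    _ = _ := by
      rw [← Real.exp_add, hexp, Real.exp_add]
      field_simp

end

/-! ### Conditional exponential moments and Ville's inequality. -/

noncomputable section

open ProbabilityTheory

/-- Integrating an `m`-measurable function against two measures, one of which dominates the other
on the σ-algebra `m`. -/
theorem MeasureTheory.lintegral_mono_of_le_on {Ω : Type*} {m m0 : MeasurableSpace Ω} (hm : m ≤ m0)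
    {μ ν : Measure[m0] Ω} (h : ∀ s, MeasurableSet[m] s → μ s ≤ ν s) {Z : Ω → ENNReal}
    (hZ : Measurable[m] Z) : ∫⁻ ω, Z ω ∂μ ≤ ∫⁻ ω, Z ω ∂ν := by
  rw [← lintegral_trim hm hZ, ← lintegral_trim hm hZ]
  refine lintegral_mono' (Measure.le_iff.2 fun s hs => ?_) le_rfl
  rw [trim_measurableSet_eq hm hs, trim_measurableSet_eq hm hs]
  exact h s hs

/-- A conditional exponential moment bound, tested against nonnegative functions. -/
theorem MeasureTheory.lintegral_mul_ofReal_le_of_condExp_le {Ω : Type*}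
    {m m0 : MeasurableSpace Ω} (hm : m ≤ m0)
    {P : Measure[m0] Ω} [IsProbabilityMeasure P] {f : Ω → ℝ} (hf : Measurable[m0] f)
    (hf0 : ∀ ω, 0 ≤ f ω)
    (hfi : Integrable f P) {c : ℝ} (hc : P[f | m] ≤ᵐ[P] fun _ => c)
    {Z : Ω → ENNReal} (hZ : Measurable[m] Z) :
    ∫⁻ ω, Z ω * ENNReal.ofReal (f ω) ∂P ≤ ENNReal.ofReal c * ∫⁻ ω, Z ω ∂P := by
  have hfm : Measurable[m0] fun ω => ENNReal.ofReal (f ω) := hf.ennreal_ofReal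
  have hZ0 : Measurable[m0] Z := hZ.mono hm le_rfl
  calc ∫⁻ ω, Z ω * ENNReal.ofReal (f ω) ∂P
      = ∫⁻ ω, Z ω ∂(P.withDensity fun ω => ENNReal.ofReal (f ω)) := by
        rw [lintegral_withDensity_eq_lintegral_mul _ hfm hZ0]
        simp [mul_comm]
    _ ≤ ∫⁻ ω, Z ω ∂(ENNReal.ofReal c • P) := by
        refine lintegral_mono_of_le_on hm (fun s hs => ?_) hZ
        have hs0 := hm s hs
        rw [withDensity_apply _ hs0, ← ofReal_integral_eq_lintegral_ofReal hfi.restrict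
          (Filter.Eventually.of_forall hf0), ← setIntegral_condExp hm hfi hs]
        have h1 : ∫ ω in s, (P[f | m]) ω ∂P ≤ ∫ _ω in s, c ∂P :=
          setIntegral_mono_ae integrable_condExp.integrableOn
            (integrable_const c).integrableOn hc
        rw [setIntegral_const, smul_eq_mul] at h1
        refine (ENNReal.ofReal_le_ofReal h1).trans ?_
        rw [mul_comm, ENNReal.ofReal_mul' measureReal_nonneg, ofReal_measureReal]
        simp
    _ = _ := by rw [lintegral_smul_measure, smul_eq_mul]

open scoped Topology in
-- The σ-algebra is an instance argument so that the conditioning σ-algebra can be supplied, which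
-- keeps the approximants measurable with respect to it.
theorem Measurable.exists_seq_finite_range_tendsto {Ω : Type*} [MeasurableSpace Ω] {f : Ω → ℝ}
    (hf : Measurable f) : ∃ r : ℕ → Ω → ℝ, (∀ k, Measurable (r k)) ∧
      (∀ k, ∃ s : Finset ℝ, ∀ ω, r k ω ∈ s) ∧
      ∀ ω, Filter.Tendsto (fun k => r k ω) Filter.atTop (𝓝 (f ω)) :=
  ⟨fun k => hf.stronglyMeasurable.approx k, fun _ => SimpleFunc.measurable _,
    fun _ => ⟨_, SimpleFunc.mem_range_self _⟩, hf.stronglyMeasurable.tendsto_approx⟩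

open scoped Topology in
/-- A conditionally sub-Gaussian variable satisfies the exponential moment bound also at random
parameters `ρ` that are measurable with respect to the conditioning σ-algebra. -/
theorem MeasureTheory.lintegral_mul_exp_le_of_condSubgaussian {Ω : Type*}
    {m m0 : MeasurableSpace Ω} (hm : m ≤ m0)
    {P : Measure[m0] Ω} [IsProbabilityMeasure P] {ε : Ω → ℝ} (hε : Measurable[m0] ε) {σ : ℝ}
    (hi : ∀ ρ : ℝ, Integrable (fun ω => Real.exp (ρ * ε ω)) P)
    (hc : ∀ ρ : ℝ, P[fun ω => Real.exp (ρ * ε ω) | m] ≤ᵐ[P] fun _ => Real.exp (ρ ^ 2 * σ ^ 2 / 2))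
    {Z : Ω → ENNReal} (hZ : Measurable[m] Z) {ρ : Ω → ℝ} (hρ : Measurable[m] ρ) :
    ∫⁻ ω, Z ω * ENNReal.ofReal (Real.exp (ρ ω * ε ω - ρ ω ^ 2 * σ ^ 2 / 2)) ∂P ≤ ∫⁻ ω, Z ω ∂P := by
  have hZ0 : Measurable[m0] Z := hZ.mono hm le_rfl
  -- For a constant parameter, the compensator exp(-r²σ²/2) is absorbed into the test function.
  -- Parameters with finitely many values follow by splitting over level sets, general ones by
  -- Fatou's lemma.
  have hconst : ∀ (r : ℝ) (Y : Ω → ENNReal), Measurable[m] Y →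
      ∫⁻ ω, Y ω * ENNReal.ofReal (Real.exp (r * ε ω - r ^ 2 * σ ^ 2 / 2)) ∂P ≤ ∫⁻ ω, Y ω ∂P := by
    intro r Y hY
    have h := lintegral_mul_ofReal_le_of_condExp_le hm (P := P) (f := fun ω => Real.exp (r * ε ω))
      (by fun_prop) (fun ω => (Real.exp_pos _).le) (hi r) (hc r)
      (hY.mul_const (ENNReal.ofReal (Real.exp (-(r ^ 2 * σ ^ 2 / 2)))))
    rw [lintegral_mul_const _ (hY.mono hm le_rfl), mul_comm (∫⁻ ω, Y ω ∂P), ← mul_assoc,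
      ← ENNReal.ofReal_mul (Real.exp_pos _).le, ← Real.exp_add, add_neg_cancel, Real.exp_zero,
      ENNReal.ofReal_one, one_mul] at h
    refine le_trans (le_of_eq (lintegral_congr fun ω => ?_)) h
    rw [mul_assoc, ← ENNReal.ofReal_mul (Real.exp_pos _).le, ← Real.exp_add]
    congr 3
    ring
  have hsimple : ∀ r : Ω → ℝ, Measurable[m] r → (∃ s : Finset ℝ, ∀ ω, r ω ∈ s) →
      ∫⁻ ω, Z ω * ENNReal.ofReal (Real.exp (r ω * ε ω - r ω ^ 2 * σ ^ 2 / 2)) ∂P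
        ≤ ∫⁻ ω, Z ω ∂P := by
    rintro r hr ⟨s, hs⟩
    have hset : ∀ c, MeasurableSet[m] (r ⁻¹' {c}) := fun c => hr (measurableSet_singleton c)
    have hsum : ∀ (F : ℝ → Ω → ENNReal) (ω : Ω),
        ∑ c ∈ s, (r ⁻¹' {c}).indicator Z ω * F c ω = Z ω * F (r ω) ω := by
      intro F ω
      rw [Finset.sum_eq_single (r ω)]
      · simp
      · intro c _ hcr
        rw [Set.indicator_of_notMem (by simpa using hcr.symm), zero_mul]
      · intro h
        exact absurd (hs ω) h
    calc _ = ∫⁻ ω, ∑ c ∈ s, (r ⁻¹' {c}).indicator Z ω *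
            ENNReal.ofReal (Real.exp (c * ε ω - c ^ 2 * σ ^ 2 / 2)) ∂P :=
          lintegral_congr fun ω => (hsum
            (fun c ω => ENNReal.ofReal (Real.exp (c * ε ω - c ^ 2 * σ ^ 2 / 2))) ω).symm
      _ = ∑ c ∈ s, ∫⁻ ω, (r ⁻¹' {c}).indicator Z ω *
            ENNReal.ofReal (Real.exp (c * ε ω - c ^ 2 * σ ^ 2 / 2)) ∂P := by
          refine lintegral_finsetSum _ fun c _ => ?_
          refine Measurable.mul (hZ0.indicator (hm _ (hset c))) ?_
          fun_prop
      _ ≤ ∑ c ∈ s, ∫⁻ ω, (r ⁻¹' {c}).indicator Z ω ∂P :=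
          Finset.sum_le_sum fun c _ => hconst c _ (hZ.indicator (hset c))
      _ = ∫⁻ ω, ∑ c ∈ s, (r ⁻¹' {c}).indicator Z ω ∂P :=
          (lintegral_finsetSum _ fun c _ => hZ0.indicator (hm _ (hset c))).symm
      _ = ∫⁻ ω, Z ω ∂P := lintegral_congr fun ω => by simpa using hsum (fun _ _ => 1) ω
  obtain ⟨r, hrm, hrf, hrt⟩ :=
    @Measurable.exists_seq_finite_range_tendsto Ω m ρ hρ
  have hlim : ∀ ω, Filter.Tendsto (fun k => Z ω * ENNReal.ofReal
      (Real.exp (r k ω * ε ω - r k ω ^ 2 * σ ^ 2 / 2))) Filter.atTop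
      (𝓝 (Z ω * ENNReal.ofReal (Real.exp (ρ ω * ε ω - ρ ω ^ 2 * σ ^ 2 / 2)))) := by
    intro ω
    have hcont : Continuous fun x : ℝ => Real.exp (x * ε ω - x ^ 2 * σ ^ 2 / 2) := by fun_prop
    refine ENNReal.Tendsto.const_mul (ENNReal.tendsto_ofReal
      ((hcont.tendsto _).comp (hrt ω))) (Or.inl ?_)
    simpa using Real.exp_pos _
  calc _ = ∫⁻ ω, Filter.liminf (fun k => Z ω * ENNReal.ofReal
      (Real.exp (r k ω * ε ω - r k ω ^ 2 * σ ^ 2 / 2))) Filter.atTop ∂P :=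
        lintegral_congr fun ω => (hlim ω).liminf_eq.symm
    _ ≤ Filter.liminf (fun k => ∫⁻ ω, Z ω * ENNReal.ofReal
      (Real.exp (r k ω * ε ω - r k ω ^ 2 * σ ^ 2 / 2)) ∂P) Filter.atTop := by
        refine lintegral_liminf_le fun k => ?_
        have hk : Measurable[m0] (r k) := (hrm k).mono hm le_rfl
        fun_prop
    _ ≤ _ := Filter.liminf_le_of_le (by isBoundedDefault) fun b hb =>
        (hb.exists.choose_spec).trans (hsimple _ (hrm _) (hrf _))

/-- The mixture over Gaussian parameters `ρ` of the exponential moment bounds. -/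
theorem MeasureTheory.lintegral_mul_gaussianMixture_le_of_condSubgaussian {Ω : Type*}
    {m m0 : MeasurableSpace Ω} (hm : m ≤ m0)
    {P : Measure[m0] Ω} [IsProbabilityMeasure P] {ε : Ω → ℝ} (hε : Measurable[m0] ε) {σ : ℝ}
    (hσ : 0 < σ) (hi : ∀ ρ : ℝ, Integrable (fun ω => Real.exp (ρ * ε ω)) P)
    (hc : ∀ ρ : ℝ, P[fun ω => Real.exp (ρ * ε ω) | m] ≤ᵐ[P] fun _ => Real.exp (ρ ^ 2 * σ ^ 2 / 2))
    {Z : Ω → ENNReal} (hZ : Measurable[m] Z) {w b : Ω → ℝ} (hw : Measurable[m] w)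
    (hb : Measurable[m] b) (hw0 : ∀ ω, 0 ≤ w ω) :
    ∫⁻ ω, Z ω * ENNReal.ofReal ((√(1 + w ω))⁻¹ * Real.exp
      ((2 * ε ω * b ω + ε ω ^ 2 * w ω - b ω ^ 2) / (1 + w ω) / (2 * σ ^ 2))) ∂P ≤
      ∫⁻ ω, Z ω ∂P := by
  have hZ0 : Measurable[m0] Z := hZ.mono hm le_rfl
  have hw1 : Measurable[m0] w := hw.mono hm le_rfl
  have hb1 : Measurable[m0] b := hb.mono hm le_rfl
  calc _ = ∫⁻ ω, ∫⁻ g, Z ω * ENNReal.ofReal (Real.exp ((b ω / σ ^ 2 + √(w ω) / σ * g) * ε ω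
        - (b ω / σ ^ 2 + √(w ω) / σ * g) ^ 2 * σ ^ 2 / 2)) ∂(gaussianReal 0 1) ∂P := by
        refine lintegral_congr fun ω => ?_
        rw [lintegral_const_mul _ (by fun_prop),
          lintegral_gaussianReal_exp_linear_sub_sq hσ (hw0 ω)]
    -- After Tonelli, g is fixed and ρ = b/σ² + (√w/σ) g is `m`-measurable, so the random-parameter
    -- bound applies for each g.
    _ = ∫⁻ g, ∫⁻ ω, Z ω * ENNReal.ofReal (Real.exp ((b ω / σ ^ 2 + √(w ω) / σ * g) * ε ω
        - (b ω / σ ^ 2 + √(w ω) / σ * g) ^ 2 * σ ^ 2 / 2)) ∂P ∂(gaussianReal 0 1) := by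
        refine lintegral_lintegral_swap (Measurable.aemeasurable ?_)
        simp only [Function.uncurry_def]
        fun_prop
    _ ≤ ∫⁻ _g, ∫⁻ ω, Z ω ∂P ∂(gaussianReal 0 1) := by
        refine lintegral_mono fun g => ?_
        refine lintegral_mul_exp_le_of_condSubgaussian hm hε hi hc hZ
          (ρ := fun ω => b ω / σ ^ 2 + √(w ω) / σ * g) ?_
        exact (hb.div_const _).add
          (((Real.continuous_sqrt.measurable.comp hw).div_const _).mul_const _)
    _ = _ := by simp

/-- Ville's maximal inequality for nonnegative supermartingales. -/
theorem MeasureTheory.mul_measure_exists_le_of_supermartingale {Ω : Type*} {m0 : MeasurableSpace Ω}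
    {P : Measure Ω} {ℱ : ℕ → MeasurableSpace Ω} (hℱ : Monotone ℱ) (hle : ∀ k, ℱ k ≤ m0)
    {M : ℕ → Ω → ENNReal} (hM : ∀ k, Measurable[ℱ k] (M k))
    (hstep : ∀ k s, MeasurableSet[ℱ k] s → ∫⁻ ω in s, M (k + 1) ω ∂P ≤ ∫⁻ ω in s, M k ω ∂P)
    (c : ENNReal) : c * P {ω | ∃ k, c ≤ M k ω} ≤ ∫⁻ ω, M 0 ω ∂P := by
  set A : ℕ → Set Ω := fun k => {ω | ∀ j ≤ k, M j ω < c} with hA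
  have hAm : ∀ k, MeasurableSet[ℱ k] (A k) := by
    intro k
    have : A k = ⋂ j ∈ Set.Iic k, {ω | M j ω < c} := by ext ω; simp [hA]
    rw [this]
    refine MeasurableSet.biInter (Set.to_countable _) fun j hj => ?_
    exact ((hM j).mono (hℱ hj) le_rfl) measurableSet_Iio
  have hAm0 : ∀ k, MeasurableSet (A k) := fun k => hle k _ (hAm k)
  have hM0 : ∀ k, Measurable (M k) := fun k => (hM k).mono (hle k) le_rfl
  have hmono : Monotone fun k => (A k)ᶜ := by
    intro i j hij
    refine Set.compl_subset_compl.2 fun ω hω l hl => hω l (hl.trans hij)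
  -- A stopping argument without stopping times: `A k` is the event that level `c` has not been
  -- reached by time k, and the left side is a lower bound for the mean of the process stopped on
  -- reaching it.
  have hinv : ∀ k, c * P (A k)ᶜ + ∫⁻ ω in A k, M k ω ∂P ≤ ∫⁻ ω, M 0 ω ∂P := by
    intro k
    induction k with
    | zero =>
      rw [← lintegral_add_compl (μ := P) (M 0) (hAm0 0), add_comm]
      refine add_le_add_right (α := ENNReal) ?_ _
      rw [← setLIntegral_const]
      refine setLIntegral_mono (hM0 0) fun ω hω => ?_
      simpa [hA] using hω
    | succ k ih =>
      have hsub : A (k + 1) ⊆ A k := fun ω hω j hj => hω j (hj.trans (Nat.le_succ k))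
      have hunion : (A (k + 1))ᶜ = (A k)ᶜ ∪ (A k \ A (k + 1)) := by
        ext ω
        by_cases h : ω ∈ A k
        · simp [h]
        · simpa [h] using fun h' => h (hsub h')
      have hk : A k = (A k \ A (k + 1)) ∪ A (k + 1) := by
        rw [Set.sdiff_union_of_subset hsub]
      have hsplit : ∫⁻ ω in A k, M (k + 1) ω ∂P =
          ∫⁻ ω in A k \ A (k + 1), M (k + 1) ω ∂P + ∫⁻ ω in A (k + 1), M (k + 1) ω ∂P := by
        conv_lhs => rw [hk]
        exact lintegral_union (hAm0 (k + 1)) Set.disjoint_sdiff_left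
      -- On this set the level is first reached exactly at time k + 1.
      have hge : c * P (A k \ A (k + 1)) ≤ ∫⁻ ω in A k \ A (k + 1), M (k + 1) ω ∂P := by
        rw [← setLIntegral_const]
        refine setLIntegral_mono (hM0 (k + 1)) fun ω hω => ?_
        by_contra! hlt
        refine hω.2 fun j hj => ?_
        rcases Nat.lt_or_ge k j with h | h
        · obtain rfl : j = k + 1 := by omega
          exact hlt
        · exact hω.1 j h
      calc c * P (A (k + 1))ᶜ + ∫⁻ ω in A (k + 1), M (k + 1) ω ∂P
          ≤ c * (P (A k)ᶜ + P (A k \ A (k + 1))) + ∫⁻ ω in A (k + 1), M (k + 1) ω ∂P := by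
            rw [hunion]
            gcongr
            exact measure_union_le _ _
        _ = c * P (A k)ᶜ + (c * P (A k \ A (k + 1)) + ∫⁻ ω in A (k + 1), M (k + 1) ω ∂P) := by
            rw [mul_add, add_assoc]
        _ ≤ c * P (A k)ᶜ + ∫⁻ ω in A k, M (k + 1) ω ∂P := by
            rw [hsplit]
            gcongr
        _ ≤ c * P (A k)ᶜ + ∫⁻ ω in A k, M k ω ∂P := by
            exact add_le_add_right (hstep k _ (hAm k)) _
        _ ≤ _ := ih
  have hset : {ω | ∃ k, c ≤ M k ω} = ⋃ k, (A k)ᶜ := by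
    ext ω
    simp only [hA, Set.mem_ofPred_eq, Set.mem_iUnion, Set.mem_compl_iff, not_forall, not_lt,
      exists_prop]
    exact ⟨fun ⟨k, hk⟩ => ⟨k, k, le_rfl, hk⟩, fun ⟨_, j, _, hj⟩ => ⟨j, hj⟩⟩
  rw [hset, hmono.measure_iUnion, ENNReal.mul_iSup]
  exact iSup_le fun k => le_self_add.trans (hinv k)

end

/-! ### Pathwise analysis: Gram matrix, confidence widths, regret. -/

noncomputable section

open Matrix

theorem EuclideanSpace.ofLp_dotProduct_ofLp {d : ℕ} (x y : EuclideanSpace ℝ (Fin d)) :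
    x.ofLp ⬝ᵥ y.ofLp = inner ℝ x y := by
  rw [EuclideanSpace.inner_eq_star_dotProduct, dotProduct_comm]
  simp

theorem EuclideanSpace.ofLp_dotProduct_self {d : ℕ} (x : EuclideanSpace ℝ (Fin d)) :
    x.ofLp ⬝ᵥ x.ofLp = ‖x‖ ^ 2 := by
  rw [EuclideanSpace.ofLp_dotProduct_ofLp, real_inner_self_eq_norm_sq]

theorem Measurable.matrix_inv_apply {Ω : Type*} [MeasurableSpace Ω] {n : Type*} [Fintype n]
    [DecidableEq n] {A : Ω → Matrix n n ℝ} (hA : ∀ i j, Measurable fun ω => A ω i j) (i j : n) :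
    Measurable fun ω => (A ω)⁻¹ i j := by
  have h : Measurable fun ω (i j : n) => A ω i j :=
    measurable_pi_lambda _ fun i => measurable_pi_lambda _ fun j => hA i j
  have hdet : Continuous fun M : n → n → ℝ => (Matrix.of M).det :=
    Continuous.matrix_det continuous_id
  have hadj : Continuous fun M : n → n → ℝ => (Matrix.of M).adjugate i j :=
    (Continuous.matrix_adjugate continuous_id).matrix_elem i j
  simp only [Matrix.inv_def, Matrix.smul_apply, Ring.inverse_eq_inv', smul_eq_mul]
  exact (hdet.measurable.comp h).inv.mul (hadj.measurable.comp h)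

theorem Measurable.matrix_det {Ω : Type*} [MeasurableSpace Ω] {n : Type*} [Fintype n]
    [DecidableEq n] {A : Ω → Matrix n n ℝ} (hA : ∀ i j, Measurable fun ω => A ω i j) :
    Measurable fun ω => (A ω).det := by
  have h : Measurable fun ω (i j : n) => A ω i j :=
    measurable_pi_lambda _ fun i => measurable_pi_lambda _ fun j => hA i j
  have hdet : Continuous fun M : n → n → ℝ => (Matrix.of M).det :=
    Continuous.matrix_det continuous_id
  exact hdet.measurable.comp h

theorem Measurable.dotProduct_mulVec {Ω : Type*} [MeasurableSpace Ω] {n : Type*} [Fintype n]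
    {A : Ω → Matrix n n ℝ} (hA : ∀ i j, Measurable fun ω => A ω i j) {u v : Ω → n → ℝ}
    (hu : ∀ i, Measurable fun ω => u ω i) (hv : ∀ i, Measurable fun ω => v ω i) :
    Measurable fun ω => u ω ⬝ᵥ A ω *ᵥ v ω := by
  simp only [dotProduct, mulVec]
  exact Finset.measurable_sum _ fun i _ => (hu i).mul
    (Finset.measurable_sum _ fun j _ => (hA i j).mul (hv j))

namespace BanditRun

variable {d K : ℕ} {Ω : Type*} (B : BanditRun d K Ω) {lam : ℝ} {t : ℕ} {ω : Ω}

/-- The noise-weighted sum of the contexts selected before round `t`. -/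
def noiseSum (θ : EuclideanSpace ℝ (Fin d)) (t : ℕ) (ω : Ω) : Fin d → ℝ :=
  ∑ s ∈ Finset.Ico 1 t, B.noise θ s ω • (B.chosen s ω).ofLp

/-- The exponential supermartingale behind the confidence ellipsoids for the regularized least
squares estimate. -/
def expMixture (θ : EuclideanSpace ℝ (Fin d)) (lam σ : ℝ) (t : ℕ) (ω : Ω) : ℝ :=
  √(lam ^ d / (B.gram lam t ω).det) *
    Real.exp ((B.noiseSum θ t ω ⬝ᵥ (B.gram lam t ω)⁻¹ *ᵥ B.noiseSum θ t ω) / (2 * σ ^ 2))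

/-- The squared norm of the selected context in the norm given by the inverse Gram matrix. -/
def width (lam : ℝ) (t : ℕ) (ω : Ω) : ℝ :=
  (B.chosen t ω).ofLp ⬝ᵥ (B.gram lam t ω)⁻¹ *ᵥ (B.chosen t ω).ofLp

theorem gram_one : B.gram lam 1 ω = lam • (1 : Matrix (Fin d) (Fin d) ℝ) := by
  simp [gram]

theorem gram_succ (ht : 1 ≤ t) : B.gram lam (t + 1) ω =
    B.gram lam t ω + vecMulVec (B.chosen t ω).ofLp (B.chosen t ω).ofLp := by
  rw [gram, gram, Finset.sum_Ico_succ_top ht, add_assoc]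

theorem noiseSum_succ (θ : EuclideanSpace ℝ (Fin d)) (ht : 1 ≤ t) : B.noiseSum θ (t + 1) ω =
    B.noiseSum θ t ω + B.noise θ t ω • (B.chosen t ω).ofLp := by
  rw [noiseSum, noiseSum, Finset.sum_Ico_succ_top ht]

theorem gram_posDef (hlam : 0 < lam) (t : ℕ) (ω : Ω) : (B.gram lam t ω).PosDef := by
  refine (Matrix.PosDef.one.smul hlam).add_posSemidef (posSemidef_sum _ fun s _ => ?_)
  simpa using posSemidef_vecMulVec_self_star (B.chosen s ω).ofLp

theorem mul_dotProduct_self_le (y : Fin d → ℝ) :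
    lam * (y ⬝ᵥ y) ≤ y ⬝ᵥ B.gram lam t ω *ᵥ y := by
  have h : 0 ≤ y ⬝ᵥ (∑ s ∈ Finset.Ico 1 t,
      vecMulVec (B.chosen s ω).ofLp (B.chosen s ω).ofLp) *ᵥ y := by
    have := (posSemidef_sum (Finset.Ico 1 t) (x := fun s =>
      vecMulVec (B.chosen s ω).ofLp (B.chosen s ω).ofLp) fun s _ => by
        simpa using posSemidef_vecMulVec_self_star (B.chosen s ω).ofLp).dotProduct_mulVec_nonneg y
    simpa using this
  rw [gram, add_mulVec, dotProduct_add, smul_mulVec, one_mulVec, dotProduct_smul, smul_eq_mul]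
  linarith

theorem dotProduct_inv_gram_le (hlam : 0 < lam) {x : EuclideanSpace ℝ (Fin d)} (hx : ‖x‖ ≤ 1) :
    x.ofLp ⬝ᵥ (B.gram lam t ω)⁻¹ *ᵥ x.ofLp ≤ 1 / lam := by
  refine ((B.gram_posDef hlam t ω).dotProduct_inv_mulVec_le hlam
    (fun y => B.mul_dotProduct_self_le y) _).trans ?_
  rw [EuclideanSpace.ofLp_dotProduct_self]
  gcongr
  exact pow_le_one₀ (norm_nonneg _) hx

theorem width_nonneg (hlam : 0 < lam) (t : ℕ) (ω : Ω) : 0 ≤ B.width lam t ω :=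
  (B.gram_posDef hlam t ω).dotProduct_inv_mulVec_nonneg _

theorem det_gram_succ (hlam : 0 < lam) (ht : 1 ≤ t) :
    (B.gram lam (t + 1) ω).det = (B.gram lam t ω).det * (1 + B.width lam t ω) := by
  rw [B.gram_succ ht, det_add_vecMulVec_self (B.gram_posDef hlam t ω).det_pos.ne'.isUnit, width]

theorem trace_gram_le (hB : ∀ s, 1 ≤ s → ‖B.chosen s ω‖ ≤ 1) (t : ℕ) :
    (B.gram lam (t + 1) ω).trace ≤ d * lam + t := by
  induction t with
  | zero => simp [gram_one, mul_comm]
  | succ t ih =>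
    rw [B.gram_succ (Nat.le_add_left 1 t), trace_add, trace_vecMulVec,
      EuclideanSpace.ofLp_dotProduct_self]
    have := pow_le_one₀ (n := 2) (norm_nonneg _) (hB (t + 1) (Nat.le_add_left 1 t))
    push_cast
    linarith

theorem det_gram_le (hd : 1 ≤ d) (hlam : 0 < lam) (hB : ∀ s, 1 ≤ s → ‖B.chosen s ω‖ ≤ 1) (t : ℕ) :
    (B.gram lam (t + 1) ω).det ≤ ((d * lam + t) / d) ^ d := by
  have : NeZero d := ⟨by omega⟩
  have hp := B.gram_posDef hlam (t + 1) ω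
  refine hp.det_le_trace_div_card_pow.trans ?_
  have h0 : 0 ≤ (B.gram lam (t + 1) ω).trace := hp.posSemidef.trace_nonneg
  rw [Fintype.card_fin]
  gcongr
  exact B.trace_gram_le hB t

/-- The trace grows by at most 1 per round, and AM-GM converts this into a determinant bound. -/
theorem log_det_gram_div_le (hd : 1 ≤ d) (hlam : 0 < lam)
    (hB : ∀ s, 1 ≤ s → ‖B.chosen s ω‖ ≤ 1) (t : ℕ) :
    Real.log ((B.gram lam (t + 1) ω).det / lam ^ d) ≤ d * Real.log ((d * lam + t) / (d * lam)) := by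
  have hd0 : (0 : ℝ) < d := by exact_mod_cast hd
  rw [← Real.log_pow]
  refine Real.log_le_log (div_pos (B.gram_posDef hlam _ ω).det_pos (by positivity)) ?_
  rw [← div_div, div_pow]
  gcongr
  exact B.det_gram_le hd hlam hB t

/-- The elliptical potential lemma. -/
theorem sum_width_mul_log_two_le (hlam : 1 ≤ lam) (hB : ∀ s, 1 ≤ s → ‖B.chosen s ω‖ ≤ 1) (T : ℕ) :
    (∑ t ∈ Finset.Icc 1 T, B.width lam t ω) * Real.log 2 ≤
      Real.log ((B.gram lam (T + 1) ω).det / lam ^ d) := by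
  have hl : 0 < lam := by linarith
  induction T with
  | zero => simp [gram_one, (pow_pos hl d).ne']
  | succ T ih =>
    have h0 := B.width_nonneg hl (T + 1) ω
    -- λ ≥ 1 enters here: it keeps each width in the range where w log 2 ≤ log(1 + w), and ∑ log(1 +
    -- w_t) telescopes to the log-determinant.
    have h1 : B.width lam (T + 1) ω ≤ 1 :=
      (B.dotProduct_inv_gram_le hl (hB (T + 1) (Nat.le_add_left 1 T))).trans
        (by rw [div_le_one hl]; exact hlam)
    have h2 := Real.mul_log_two_le_log_one_add h0 h1
    have h3 := (B.gram_posDef hl (T + 1) ω).det_pos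
    rw [Finset.sum_Icc_succ_top (Nat.le_add_left 1 T), B.det_gram_succ hl (Nat.le_add_left 1 T),
      mul_div_right_comm, Real.log_mul (by positivity) (by positivity)]
    linarith

/-- Substitute r_s = θᵀ x_s + ε_s and ∑ x_s x_sᵀ = V - λI. Applying V⁻¹ gives θ̂ - θ = V⁻¹ S - λ V⁻¹
θ. -/
theorem sum_rew_smul_chosen (θ : EuclideanSpace ℝ (Fin d)) :
    ∑ s ∈ Finset.Ico 1 t, B.rew s ω • (B.chosen s ω).ofLp =
      B.noiseSum θ t ω + B.gram lam t ω *ᵥ θ.ofLp - lam • θ.ofLp := by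
  rw [noiseSum, gram, add_mulVec, smul_mulVec, one_mulVec, add_sub_assoc, add_sub_cancel_left,
    sum_mulVec, ← Finset.sum_add_distrib]
  refine Finset.sum_congr rfl fun s _ => ?_
  ext i
  simp [vecMulVec_mulVec, noise, EuclideanSpace.ofLp_dotProduct_ofLp, real_inner_comm]
  ring

/-- The confidence bound for the regularized least squares estimate. -/
theorem abs_estimate_dotProduct_sub_le (hlam : 0 < lam) {θ : EuclideanSpace ℝ (Fin d)}
    (hθ : ‖θ‖ ≤ 1) (z : Fin d → ℝ) :
    |B.estimate lam t ω ⬝ᵥ z - θ.ofLp ⬝ᵥ z| ≤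
      (√(B.noiseSum θ t ω ⬝ᵥ (B.gram lam t ω)⁻¹ *ᵥ B.noiseSum θ t ω) + √lam) *
        √(z ⬝ᵥ (B.gram lam t ω)⁻¹ *ᵥ z) := by
  have hp := B.gram_posDef hlam t ω
  set V := B.gram lam t ω with hV
  set S := B.noiseSum θ t ω
  have h1 : B.estimate lam t ω ⬝ᵥ z - θ.ofLp ⬝ᵥ z = z ⬝ᵥ V⁻¹ *ᵥ S - lam * (z ⬝ᵥ V⁻¹ *ᵥ θ.ofLp) := by
    rw [estimate, B.sum_rew_smul_chosen (lam := lam) θ, ← hV, mulVec_sub, mulVec_add, mulVec_mulVec,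
      nonsing_inv_mul _ hp.det_pos.ne'.isUnit, one_mulVec, mulVec_smul, sub_dotProduct,
      add_dotProduct, smul_dotProduct, dotProduct_comm _ z, dotProduct_comm _ z, smul_eq_mul,
      dotProduct_comm _ z]
    ring
  have hcs : ∀ u : Fin d → ℝ, |z ⬝ᵥ V⁻¹ *ᵥ u| ≤ √(z ⬝ᵥ V⁻¹ *ᵥ z) * √(u ⬝ᵥ V⁻¹ *ᵥ u) := by
    intro u
    rw [← Real.sqrt_mul (hp.dotProduct_inv_mulVec_nonneg z)]
    exact Real.abs_le_sqrt (hp.inv.posSemidef.sq_dotProduct_mulVec_le z u)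
  -- The regularization bias: V ≥ λI and ‖θ‖ ≤ 1 give θᵀ V⁻¹ θ ≤ 1/λ.
  have h2 : lam * √(θ.ofLp ⬝ᵥ V⁻¹ *ᵥ θ.ofLp) ≤ √lam := by
    calc lam * √(θ.ofLp ⬝ᵥ V⁻¹ *ᵥ θ.ofLp) ≤ lam * √(1 / lam) := by
          gcongr
          exact B.dotProduct_inv_gram_le hlam hθ
      _ = √lam := by
          rw [one_div, Real.sqrt_inv, ← div_eq_mul_inv, Real.div_sqrt]
  rw [h1]
  calc _ ≤ |z ⬝ᵥ V⁻¹ *ᵥ S| + lam * |z ⬝ᵥ V⁻¹ *ᵥ θ.ofLp| := by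
        refine (abs_sub _ _).trans_eq ?_
        rw [abs_mul, abs_of_pos hlam]
    _ ≤ √(z ⬝ᵥ V⁻¹ *ᵥ z) * √(S ⬝ᵥ V⁻¹ *ᵥ S) +
          lam * (√(z ⬝ᵥ V⁻¹ *ᵥ z) * √(θ.ofLp ⬝ᵥ V⁻¹ *ᵥ θ.ofLp)) := by
        gcongr
        · exact hcs _
        · exact hcs _
    _ = √(z ⬝ᵥ V⁻¹ *ᵥ z) * √(S ⬝ᵥ V⁻¹ *ᵥ S) +
          √(z ⬝ᵥ V⁻¹ *ᵥ z) * (lam * √(θ.ofLp ⬝ᵥ V⁻¹ *ᵥ θ.ofLp)) := by ring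
    _ ≤ √(z ⬝ᵥ V⁻¹ *ᵥ z) * √(S ⬝ᵥ V⁻¹ *ᵥ S) + √(z ⬝ᵥ V⁻¹ *ᵥ z) * √lam := by gcongr
    _ = _ := by ring

/-- The instantaneous regret of the LinRBMLE policy on the confidence event. -/
theorem iSup_sub_inner_chosen_le (hlam : 0 < lam) {θ : EuclideanSpace ℝ (Fin d)} (hθ : ‖θ‖ ≤ 1)
    {α : ℕ → ℝ} (hα : 0 < α t)
    (hact : ∀ a, B.index lam α t a ω ≤ B.index lam α t (B.act t ω) ω) {β : ℝ}
    (hβ : √(B.noiseSum θ t ω ⬝ᵥ (B.gram lam t ω)⁻¹ *ᵥ B.noiseSum θ t ω) + √lam ≤ β) :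
    (⨆ a : Fin K, inner ℝ θ (B.ctx t a ω)) - inner ℝ θ (B.chosen t ω) ≤
      β ^ 2 * (1 / (2 * α t)) + β * √(B.width lam t ω) + 1 / 2 * α t * B.width lam t ω := by
  -- The selected arm itself shows K > 0, so the supremum is not the default value of an empty one.
  have : Nonempty (Fin K) := ⟨B.act t ω⟩
  rw [sub_le_iff_le_add]
  refine ciSup_le fun a => ?_
  have hz := B.abs_estimate_dotProduct_sub_le (t := t) (ω := ω) hlam hθ (B.ctx t a ω).ofLp
  have hx := B.abs_estimate_dotProduct_sub_le (t := t) (ω := ω) hlam hθ (B.chosen t ω).ofLp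
  have ha := hact a
  simp only [index] at ha
  change _ ≤ B.estimate lam t ω ⬝ᵥ (B.chosen t ω).ofLp + 1 / 2 * α t * B.width lam t ω at ha
  have hz0 := (B.gram_posDef hlam t ω).dotProduct_inv_mulVec_nonneg (B.ctx t a ω).ofLp
  rw [← width] at hx
  rw [EuclideanSpace.ofLp_dotProduct_ofLp θ] at hz hx
  set q := (B.ctx t a ω).ofLp ⬝ᵥ (B.gram lam t ω)⁻¹ *ᵥ (B.ctx t a ω).ofLp
  have hz' := (abs_le.1 (hz.trans (mul_le_mul_of_nonneg_right hβ (Real.sqrt_nonneg _)))).1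
  have hx' := (abs_le.1 (hx.trans (mul_le_mul_of_nonneg_right hβ (Real.sqrt_nonneg _)))).2
  -- Completing the square in √q; the maximum β²/(2α) is at √q = β/α. This removes the width of the
  -- competing arm.
  have hq : β * √q - 1 / 2 * α t * q ≤ β ^ 2 * (1 / (2 * α t)) := by
    have e : β ^ 2 * (1 / (2 * α t)) - (β * √q - 1 / 2 * α t * √q ^ 2) =
        (β - α t * √q) ^ 2 / (2 * α t) := by
      field_simp
      ring
    have : 0 ≤ (β - α t * √q) ^ 2 / (2 * α t) := by positivity
    rw [Real.sq_sqrt hz0] at e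
    linarith
  linarith

theorem regret_le_regretBound (hlam : 0 < lam) {θ : EuclideanSpace ℝ (Fin d)} (hθ : ‖θ‖ ≤ 1)
    {α : ℕ → ℝ} (hα : ∀ t, 1 ≤ t → 0 < α t) (hmono : MonotoneOn α (Set.Ici 1))
    (hact : B.FollowsLinRBMLE lam α) {T : ℕ} (hT : 1 ≤ T) {β g : ℝ} (hg : 0 ≤ g)
    (hβ : ∀ t ∈ Finset.Icc 1 T,
      √(B.noiseSum θ t ω ⬝ᵥ (B.gram lam t ω)⁻¹ *ᵥ B.noiseSum θ t ω) + √lam ≤ β)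
    (hsum : ∑ t ∈ Finset.Icc 1 T, B.width lam t ω ≤ g ^ 2) :
    B.regret θ T ω ≤ regretBound α β g T := by
  have hβ0 : 0 ≤ β := le_trans (by positivity) (hβ T (by simp [hT]))
  have hw := B.width_nonneg hlam (ω := ω)
  have hsqrt : ∑ t ∈ Finset.Icc 1 T, √(B.width lam t ω) ≤ √T * g := by
    have h := sq_sum_le_card_mul_sum_sq (s := Finset.Icc 1 T) (f := fun t => √(B.width lam t ω))
    simp only [Real.sq_sqrt (hw _), Nat.card_Icc, Nat.add_sub_cancel] at h
    calc _ ≤ √((T : ℝ) * g ^ 2) := Real.le_sqrt_of_sq_le (h.trans (by gcongr))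
      _ = √T * g := by rw [Real.sqrt_mul (Nat.cast_nonneg T), Real.sqrt_sq hg]
  have hαsum : ∑ t ∈ Finset.Icc 1 T, 1 / 2 * α t * B.width lam t ω ≤ 1 / 2 * α T * g ^ 2 := by
    calc _ ≤ ∑ t ∈ Finset.Icc 1 T, 1 / 2 * α T * B.width lam t ω := by
          refine Finset.sum_le_sum fun t ht => ?_
          rw [Finset.mem_Icc] at ht
          have := hmono (Set.mem_Ici.2 ht.1) (Set.mem_Ici.2 hT) ht.2
          have := hw t
          gcongr
      _ ≤ _ := by
          rw [← Finset.mul_sum]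
          have := hα T hT
          gcongr
  calc B.regret θ T ω ≤ ∑ t ∈ Finset.Icc 1 T, (β ^ 2 * (1 / (2 * α t)) + β * √(B.width lam t ω) +
        1 / 2 * α t * B.width lam t ω) :=
        Finset.sum_le_sum fun t ht => B.iSup_sub_inner_chosen_le hlam hθ
          (hα t (Finset.mem_Icc.1 ht).1) (hact t (Finset.mem_Icc.1 ht).1 ω) (hβ t ht)
    _ = β ^ 2 * ∑ t ∈ Finset.Icc 1 T, 1 / (2 * α t) +
        β * ∑ t ∈ Finset.Icc 1 T, √(B.width lam t ω) +
        ∑ t ∈ Finset.Icc 1 T, 1 / 2 * α t * B.width lam t ω := by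
        rw [Finset.sum_add_distrib, Finset.sum_add_distrib, Finset.mul_sum, Finset.mul_sum]
    _ ≤ β ^ 2 * ∑ t ∈ Finset.Icc 1 T, 1 / (2 * α t) + β * (√T * g) + 1 / 2 * α T * g ^ 2 := by
        gcongr
    _ = _ := by rw [regretBound]; ring

end BanditRun

end

/-! ### The exponential supermartingale and its maximal inequality. -/

noncomputable section

open Matrix

namespace BanditRun

variable {d K : ℕ} {Ω : Type*} (B : BanditRun d K Ω) {lam : ℝ} {t : ℕ} {ω : Ω}

/-- Shifted by one so that index 0 of the filtration is round 1, where the exponential mixture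
equals 1. -/
theorem history_mono : Monotone fun t => B.history (t + 1) := by
  intro s t hst
  have h1 : Set.Icc 1 (s + 1) ⊆ Set.Icc 1 (t + 1) := Set.Icc_subset_Icc_right (by omega)
  have h2 : Set.Ico 1 (s + 1) ⊆ Set.Ico 1 (t + 1) := Set.Ico_subset_Ico_right (by omega)
  exact sup_le_sup (sup_le_sup (biSup_mono h1) (biSup_mono h2)) (biSup_mono h2)

theorem measurable_chosen_history {s : ℕ} (hs : 1 ≤ s) (hst : s ≤ t) :
    Measurable[B.history t] (B.chosen s) := by
  refine Measurable.mono (comap_measurable (B.chosen s)) ?_ le_rfl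
  exact (le_biSup (fun s => MeasurableSpace.comap (B.chosen s) inferInstance)
    (Set.mem_Icc.2 ⟨hs, hst⟩)).trans (le_sup_left.trans le_sup_left)

theorem measurable_rew_history {s : ℕ} (hs : 1 ≤ s) (hst : s < t) :
    Measurable[B.history t] (B.rew s) := by
  refine Measurable.mono (comap_measurable (B.rew s)) ?_ le_rfl
  exact (le_biSup (fun s => MeasurableSpace.comap (B.rew s) inferInstance)
    (Set.mem_Ico.2 ⟨hs, hst⟩)).trans le_sup_right

section Measurability

variable [MeasurableSpace Ω] {B}

theorem measurable_chosen_apply {s : ℕ} (h : Measurable (B.chosen s)) (i : Fin d) :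
    Measurable fun ω => (B.chosen s ω).ofLp i :=
  (PiLp.continuous_apply 2 _ i).measurable.comp h

theorem measurable_noise (θ : EuclideanSpace ℝ (Fin d)) {s : ℕ} (hc : Measurable (B.chosen s))
    (hr : Measurable (B.rew s)) : Measurable (B.noise θ s) :=
  hr.sub (Measurable.const_inner hc)

theorem measurable_gram_apply (hc : ∀ s ∈ Finset.Ico 1 t, Measurable (B.chosen s)) (i j : Fin d) :
    Measurable fun ω => B.gram lam t ω i j := by
  simp only [gram, Matrix.add_apply, Matrix.sum_apply, vecMulVec_apply]
  exact measurable_const.add (Finset.measurable_sum _ fun s hs =>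
    (measurable_chosen_apply (hc s hs) i).mul (measurable_chosen_apply (hc s hs) j))

theorem measurable_noiseSum_apply (θ : EuclideanSpace ℝ (Fin d))
    (hc : ∀ s ∈ Finset.Ico 1 t, Measurable (B.chosen s))
    (hr : ∀ s ∈ Finset.Ico 1 t, Measurable (B.rew s)) (i : Fin d) :
    Measurable fun ω => B.noiseSum θ t ω i := by
  simp only [noiseSum, Finset.sum_apply, Pi.smul_apply, smul_eq_mul]
  exact Finset.measurable_sum _ fun s hs =>
    (measurable_noise θ (hc s hs) (hr s hs)).mul (measurable_chosen_apply (hc s hs) i)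

theorem measurable_expMixture (θ : EuclideanSpace ℝ (Fin d)) (σ : ℝ)
    (hc : ∀ s ∈ Finset.Ico 1 t, Measurable (B.chosen s))
    (hr : ∀ s ∈ Finset.Ico 1 t, Measurable (B.rew s)) :
    Measurable (B.expMixture θ lam σ t) := by
  have hV := measurable_gram_apply (lam := lam) hc
  have hS := measurable_noiseSum_apply θ hc hr
  have h1 := Measurable.dotProduct_mulVec (Measurable.matrix_inv_apply hV) hS hS
  have h2 := Measurable.matrix_det hV
  unfold expMixture
  fun_prop

theorem measurable_width (hc : ∀ s ∈ Finset.Icc 1 t, Measurable (B.chosen s)) (ht : 1 ≤ t) :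
    Measurable (B.width lam t) := by
  have hV := measurable_gram_apply (lam := lam)
    fun s hs => hc s (Finset.Ico_subset_Icc_self hs)
  have hx := measurable_chosen_apply (hc t (Finset.right_mem_Icc.2 ht))
  exact Measurable.dotProduct_mulVec (Measurable.matrix_inv_apply hV) hx hx

/-- Contexts through round t but rewards only before t: exactly what the history of round t
provides. Hence this quantity, like the width, is known before the noise of round t. -/
theorem measurable_chosen_dotProduct_inv_gram_noiseSum (θ : EuclideanSpace ℝ (Fin d))
    (hc : ∀ s ∈ Finset.Icc 1 t, Measurable (B.chosen s))
    (hr : ∀ s ∈ Finset.Ico 1 t, Measurable (B.rew s)) (ht : 1 ≤ t) :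
    Measurable fun ω =>
      (B.chosen t ω).ofLp ⬝ᵥ (B.gram lam t ω)⁻¹ *ᵥ B.noiseSum θ t ω := by
  have hc' : ∀ s ∈ Finset.Ico 1 t, Measurable (B.chosen s) :=
    fun s hs => hc s (Finset.Ico_subset_Icc_self hs)
  exact Measurable.dotProduct_mulVec (Measurable.matrix_inv_apply (measurable_gram_apply hc'))
    (measurable_chosen_apply (hc t (Finset.right_mem_Icc.2 ht)))
    (measurable_noiseSum_apply θ hc' hr)

end Measurability

theorem expMixture_one (hlam : 0 < lam) (θ : EuclideanSpace ℝ (Fin d)) (σ : ℝ) :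
    B.expMixture θ lam σ 1 ω = 1 := by
  simp [expMixture, gram_one, noiseSum, (pow_pos hlam d).ne']

theorem expMixture_nonneg (θ : EuclideanSpace ℝ (Fin d)) (σ : ℝ) :
    0 ≤ B.expMixture θ lam σ t ω := by
  unfold expMixture
  positivity

/-- The determinant update supplies the square root and the Sherman-Morrison update the exponent.
The factor is the closed form of the Gaussian mixture with e = ε_t, m = x_tᵀ V_t⁻¹ S_t and w = w_t.
-/
theorem expMixture_succ (hlam : 0 < lam) (θ : EuclideanSpace ℝ (Fin d)) (σ : ℝ) (ht : 1 ≤ t) :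
    B.expMixture θ lam σ (t + 1) ω = B.expMixture θ lam σ t ω * ((√(1 + B.width lam t ω))⁻¹ *
      Real.exp ((2 * B.noise θ t ω *
          ((B.chosen t ω).ofLp ⬝ᵥ (B.gram lam t ω)⁻¹ *ᵥ B.noiseSum θ t ω) +
        B.noise θ t ω ^ 2 * B.width lam t ω -
          ((B.chosen t ω).ofLp ⬝ᵥ (B.gram lam t ω)⁻¹ *ᵥ B.noiseSum θ t ω) ^ 2) /
        (1 + B.width lam t ω) / (2 * σ ^ 2))) := by
  have hp := B.gram_posDef hlam t ω
  have hw := B.width_nonneg hlam t ω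
  have hdet := hp.det_pos
  rw [expMixture, B.det_gram_succ hlam ht, B.gram_succ ht, B.noiseSum_succ θ ht,
    hp.dotProduct_inv_add_vecMulVec_self_mulVec, add_div, Real.exp_add, ← div_div,
    Real.sqrt_div (by positivity), expMixture, ← width]
  ring

variable [MeasurableSpace Ω] {B} {P : Measure Ω} {θ : EuclideanSpace ℝ (Fin d)} {σ : ℝ}

theorem IsStandardLinear.measurable_chosen (hB : B.IsStandardLinear P θ σ) (ht : 1 ≤ t) :
    Measurable (B.chosen t) := by
  have h : Measurable fun p : Fin K × Ω => B.ctx t p.1 p.2 :=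
    measurable_from_prod_countable_right fun a => hB.measurable_ctx t ht a
  exact h.comp ((hB.measurable_act t ht).prodMk measurable_id)

theorem IsStandardLinear.history_le (hB : B.IsStandardLinear P θ σ) (t : ℕ) :
    B.history t ≤ ‹MeasurableSpace Ω› := by
  refine sup_le (sup_le ?_ ?_) ?_
  · exact iSup₂_le fun s hs => (hB.measurable_chosen hs.1).comap_le
  · exact iSup₂_le fun s hs => (hB.measurable_act s hs.1).comap_le
  · exact iSup₂_le fun s hs => (hB.measurable_rew s hs.1).comap_le

/-- The self-normalized maximal inequality. -/
theorem IsStandardLinear.measure_exists_le_expMixture_le [IsProbabilityMeasure P]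
    (hB : B.IsStandardLinear P θ σ) (hσ : 0 < σ) (hlam : 0 < lam) {δ : ℝ} (hδ : 0 < δ) :
    P {ω | ∃ k, 1 / δ ≤ B.expMixture θ lam σ (k + 1) ω} ≤ ENNReal.ofReal δ := by
  have hcm : ∀ t, ∀ s ∈ Finset.Icc 1 t, Measurable[B.history t] (B.chosen s) := fun t s hs =>
    B.measurable_chosen_history (Finset.mem_Icc.1 hs).1 (Finset.mem_Icc.1 hs).2
  have hrm : ∀ t, ∀ s ∈ Finset.Ico 1 t, Measurable[B.history t] (B.rew s) := fun t s hs =>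
    B.measurable_rew_history (Finset.mem_Ico.1 hs).1 (Finset.mem_Ico.1 hs).2
  have hMm : ∀ k, Measurable[B.history (k + 1)] fun ω =>
      ENNReal.ofReal (B.expMixture θ lam σ (k + 1) ω) := fun k =>
    (@measurable_expMixture d K Ω B lam (k + 1) (B.history (k + 1)) θ σ
      (fun s hs => hcm _ s (Finset.Ico_subset_Icc_self hs)) (hrm _)).ennreal_ofReal
  have hville := mul_measure_exists_le_of_supermartingale (P := P) B.history_mono
    (fun k => hB.history_le (k + 1)) hMm (fun k s hs => ?_) (ENNReal.ofReal (1 / δ))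
  · simp only [zero_add, B.expMixture_one hlam, ENNReal.ofReal_one, lintegral_one, measure_univ,
      ENNReal.ofReal_le_ofReal_iff (B.expMixture_nonneg θ σ)] at hville
    calc _ = ENNReal.ofReal δ * (ENNReal.ofReal (1 / δ) *
          P {ω | ∃ k, 1 / δ ≤ B.expMixture θ lam σ (k + 1) ω}) := by
          rw [← mul_assoc, ← ENNReal.ofReal_mul hδ.le, mul_one_div_cancel hδ.ne',
            ENNReal.ofReal_one, one_mul]
      _ ≤ ENNReal.ofReal δ * 1 := by gcongr
      _ = _ := mul_one _
  · have h1 : 1 ≤ k + 1 := Nat.le_add_left 1 k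
    have hs0 := hB.history_le (k + 1) s hs
    rw [← lintegral_indicator hs0, ← lintegral_indicator hs0]
    -- The supermartingale step on `s` is the mixture bound with test function 1_s M_{k+1}.
    refine le_trans (le_of_eq (lintegral_congr fun ω => ?_))
      (lintegral_mul_gaussianMixture_le_of_condSubgaussian (hB.history_le (k + 1))
        (measurable_noise θ (hB.measurable_chosen h1) (hB.measurable_rew _ h1)) hσ
        (hB.integrable_exp_noise _ h1) (hB.subgaussian_noise _ h1)
        ((hMm k).indicator hs)
        (@measurable_width d K Ω B lam (k + 1) (B.history (k + 1)) (hcm _) h1)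
        (@measurable_chosen_dotProduct_inv_gram_noiseSum d K Ω B lam (k + 1) (B.history (k + 1)) θ
          (hcm _) (hrm _) h1)
        (B.width_nonneg hlam (k + 1)))
    by_cases hω : ω ∈ s
    · rw [Set.indicator_of_mem hω, Set.indicator_of_mem hω, B.expMixture_succ hlam θ σ h1,
        ENNReal.ofReal_mul (B.expMixture_nonneg θ σ)]
    · rw [Set.indicator_of_notMem hω, Set.indicator_of_notMem hω, zero_mul]

end BanditRun

end

/-! ### Explicit constants and the high-probability bound. -/

noncomputable section

open Matrix

namespace BanditRun

variable {d K : ℕ} {Ω : Type*} (B : BanditRun d K Ω) {lam : ℝ} {t : ℕ} {ω : Ω}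

theorem sqrt_noiseSum_add_sqrt_le_G0 (hd : 1 ≤ d) (hlam : 0 < lam)
    (hB : ∀ s, 1 ≤ s → ‖B.chosen s ω‖ ≤ 1) {θ : EuclideanSpace ℝ (Fin d)} {σ δ : ℝ} (hσ : 0 < σ)
    (hδ0 : 0 < δ) (hδ1 : δ < 1) (hM : B.expMixture θ lam σ (t + 1) ω < 1 / δ) {T : ℕ}
    (hT : t ≤ T) :
    √(B.noiseSum θ (t + 1) ω ⬝ᵥ (B.gram lam (t + 1) ω)⁻¹ *ᵥ B.noiseSum θ (t + 1) ω) + √lam ≤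
      G0 d lam σ δ T := by
  have hd0 : (0 : ℝ) < d := by exact_mod_cast hd
  have hdet := (B.gram_posDef hlam (t + 1) ω).det_pos
  have hlog := B.log_det_gram_div_le hd hlam hB t
  have hδlog : 0 ≤ Real.log (1 / δ) := Real.log_nonneg (by rw [le_div_iff₀ hδ0]; linarith)
  have hmono : Real.log ((d * lam + t) / (d * lam)) ≤ Real.log ((lam + T) / lam) := by
    refine Real.log_le_log (by positivity) ?_
    rw [div_le_div_iff₀ (by positivity) hlam]
    have h1 : (t : ℝ) ≤ d * T := by
      have : (1 : ℝ) ≤ d := by exact_mod_cast hd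
      have : (t : ℝ) ≤ T := by exact_mod_cast hT
      nlinarith
    nlinarith
  rw [expMixture] at hM
  have hlt := Real.log_lt_log (by positivity) hM
  rw [Real.log_mul (by positivity) (by positivity), Real.log_exp, Real.log_sqrt (by positivity),
    ← inv_div _ (lam ^ d), Real.log_inv] at hlt
  set q := B.noiseSum θ (t + 1) ω ⬝ᵥ (B.gram lam (t + 1) ω)⁻¹ *ᵥ B.noiseSum θ (t + 1) ω
  -- Solving M < 1/δ for the quadratic form q gives q < σ² (log(det V / λ^d) + 2 log(1/δ)), so the
  -- factor 2 is what the maximum must dominate.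
  have hmax : (2 : ℝ) ≤ (max d 2 : ℕ) := by exact_mod_cast le_max_right d 2
  have hq : q ≤ σ ^ 2 * (d * Real.log ((lam + T) / lam) + (max d 2 : ℕ) * Real.log (1 / δ)) := by
    have h1 : q / (2 * σ ^ 2) ≤
        (d * Real.log ((lam + T) / lam) + (max d 2 : ℕ) * Real.log (1 / δ)) / 2 := by
      nlinarith
    rw [div_le_iff₀ (by positivity)] at h1
    linarith
  rw [G0]
  gcongr
  calc √q ≤ √(σ ^ 2 * (d * Real.log ((lam + T) / lam) + (max d 2 : ℕ) * Real.log (1 / δ))) :=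
        Real.sqrt_le_sqrt hq
    _ = _ := by rw [Real.sqrt_mul (by positivity), Real.sqrt_sq hσ.le]

theorem sum_width_mul_log_two_le_log (hd : 1 ≤ d) (hlam : 1 ≤ lam)
    (hB : ∀ s, 1 ≤ s → ‖B.chosen s ω‖ ≤ 1) (T : ℕ) :
    (∑ t ∈ Finset.Icc 1 T, B.width lam t ω) * Real.log 2 ≤
      d * Real.log ((d * lam + T) / (d * lam)) :=
  (B.sum_width_mul_log_two_le hlam hB T).trans
    (B.log_det_gram_div_le hd (by linarith) hB T)

/-- The potential bound has factor 1/log 2 ≤ 2, and λ ≥ 1 allows λ to be dropped from the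
denominator. -/
theorem sum_width_le_sq_G1 (hd : 1 ≤ d) (hlam : 1 ≤ lam)
    (hB : ∀ s, 1 ≤ s → ‖B.chosen s ω‖ ≤ 1) (T : ℕ) :
    ∑ t ∈ Finset.Icc 1 T, B.width lam t ω ≤ G1 d lam T ^ 2 := by
  have hd0 : (0 : ℝ) < d := by exact_mod_cast hd
  have hl : 0 < lam := by linarith
  have h := B.sum_width_mul_log_two_le_log hd hlam hB T
  have h1 : Real.log ((d * lam + T) / (d * lam)) ≤ Real.log ((d * lam + T) / d) := by
    refine Real.log_le_log (by positivity) ?_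
    gcongr
    exact le_mul_of_one_le_right hd0.le hlam
  have h2 : 0 ≤ Real.log ((d * lam + T) / d) := by
    refine Real.log_nonneg ?_
    rw [one_le_div hd0]
    nlinarith [Nat.cast_nonneg (α := ℝ) T]
  rw [G1, Real.sq_sqrt (by positivity)]
  have h3 := Real.log_two_gt_d9
  refine le_of_mul_le_mul_right (h.trans ?_) (Real.log_pos one_lt_two)
  nlinarith [mul_nonneg hd0.le h2, mul_le_mul_of_nonneg_left h1 hd0.le]

/-- Here (dλ + T)/(dλ) ≤ 1 + T/d, and the slack between 1/log 2 and 2 pays for replacing 1 + T/d by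
T/d. -/
theorem sum_width_le_sq_G1' (hd : 1 ≤ d) (hlam : 1 ≤ lam)
    (hB : ∀ s, 1 ≤ s → ‖B.chosen s ω‖ ≤ 1) {T : ℕ} (hT : 3 * d ≤ T) :
    ∑ t ∈ Finset.Icc 1 T, B.width lam t ω ≤ G1' d lam T ^ 2 := by
  have hd0 : (0 : ℝ) < d := by exact_mod_cast hd
  have hl : 0 < lam := by linarith
  have hT' : (3 : ℝ) ≤ T / d := by
    rw [le_div_iff₀ hd0]
    exact_mod_cast hT
  have h := B.sum_width_mul_log_two_le_log hd hlam hB T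
  have h1 : Real.log ((d * lam + T) / (d * lam)) ≤ Real.log (1 + T / d) := by
    refine Real.log_le_log (by positivity) ?_
    rw [add_div, div_self (by positivity)]
    gcongr
    exact le_mul_of_one_le_right hd0.le hlam
  have h2 := Real.log_one_add_le_two_mul_log_two_mul_log hT'
  have h3 : Real.log (T / d) ≤ Real.log ((lam + T) / d) := by
    refine Real.log_le_log (by linarith) ?_
    gcongr
    linarith
  have h4 : 0 ≤ Real.log (T / d) := Real.log_nonneg (by linarith)
  have h5 := Real.log_pos one_lt_two
  rw [G1', Real.sq_sqrt (mul_nonneg (by positivity) (h4.trans h3))]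
  refine le_of_mul_le_mul_right (h.trans ?_) h5
  calc d * Real.log ((d * lam + T) / (d * lam))
      ≤ d * (2 * Real.log 2 * Real.log ((lam + T) / d)) := by
        gcongr
        exact h1.trans (h2.trans (by gcongr))
    _ = _ := by ring

/-- The regret bounds for the LinRBMLE policy. -/
theorem IsStandardLinear.one_sub_le_measureReal_regret_le (hd : 1 ≤ d) (hlam : 1 ≤ lam)
    {B : BanditRun d K Ω} [MeasurableSpace Ω] {P : Measure Ω} [IsProbabilityMeasure P]
    {θ : EuclideanSpace ℝ (Fin d)} {σ δ : ℝ} (hσ : 0 < σ) (hδ0 : 0 < δ) (hδ1 : δ < 1)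
    {α : ℕ → ℝ} (hα : ∀ t, 1 ≤ t → 0 < α t) (hmono : MonotoneOn α (Set.Ici 1))
    (hB : B.IsStandardLinear P θ σ) (hact : B.FollowsLinRBMLE lam α) :
    1 - δ ≤ P.real {ω | ∀ T : ℕ, 1 ≤ T →
      B.regret θ T ω ≤ regretBound α (G0 d lam σ δ T) (G1 d lam T) T ∧
      (3 * d ≤ T → B.regret θ T ω ≤ regretBound α (G0 d lam σ δ T) (G1' d lam T) T)} := by
  have hl : 0 < lam := by linarith
  -- This event depends on neither T nor α, so all horizons and both forms of the bound hold off the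
  -- same exceptional set.
  set bad := {ω | ∃ k, 1 / δ ≤ B.expMixture θ lam σ (k + 1) ω} with hbad
  have hbadm : MeasurableSet bad := by
    have : bad = ⋃ k, {ω | 1 / δ ≤ B.expMixture θ lam σ (k + 1) ω} := by
      ext ω
      simp [hbad]
    rw [this]
    refine MeasurableSet.iUnion fun k => measurableSet_le measurable_const ?_
    exact measurable_expMixture θ σ
      (fun s hs => hB.measurable_chosen (Finset.mem_Ico.1 hs).1)
      (fun s hs => hB.measurable_rew s (Finset.mem_Ico.1 hs).1)
  have hbadP : P.real bad ≤ δ :=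
    ENNReal.toReal_le_of_le_ofReal hδ0.le (hB.measure_exists_le_expMixture_le hσ hl hδ0)
  calc 1 - δ ≤ P.real badᶜ := by
        rw [probReal_compl_eq_one_sub hbadm]
        linarith
    _ ≤ _ := by
      -- Only monotonicity of the measure is used, so measurability of the regret event is not
      -- needed.
      refine measureReal_mono fun ω hω T hT => ?_
      have hgood : ∀ k, B.expMixture θ lam σ (k + 1) ω < 1 / δ := by
        simpa [hbad] using hω
      have hx : ∀ s, 1 ≤ s → ‖B.chosen s ω‖ ≤ 1 := fun s hs => hB.norm_ctx_le s hs _ ω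
      have hβ : ∀ t ∈ Finset.Icc 1 T,
          √(B.noiseSum θ t ω ⬝ᵥ (B.gram lam t ω)⁻¹ *ᵥ B.noiseSum θ t ω) + √lam ≤
            G0 d lam σ δ T := by
        intro t ht
        rw [Finset.mem_Icc] at ht
        obtain ⟨k, rfl⟩ : ∃ k, t = k + 1 := ⟨t - 1, by omega⟩
        exact B.sqrt_noiseSum_add_sqrt_le_G0 hd hl hx hσ hδ0 hδ1 (hgood k) (by omega)
      exact ⟨B.regret_le_regretBound hl hB.norm_param_le hα hmono hact hT (Real.sqrt_nonneg _) hβ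
          (B.sum_width_le_sq_G1 hd hlam hx T),
        fun h => B.regret_le_regretBound hl hB.norm_param_le hα hmono hact hT (Real.sqrt_nonneg _)
          hβ (B.sum_width_le_sq_G1' hd hlam hx h)⟩

end BanditRun

/-! ### The choice α(t) = √t. -/

/-- Telescoping: 1/(2√(T+1)) ≤ √(T+1) - √T. -/
theorem sum_one_div_two_mul_sqrt_le (T : ℕ) :
    ∑ t ∈ Finset.Icc 1 T, 1 / (2 * √(t : ℝ)) ≤ √(T : ℝ) := by
  induction T with
  | zero => simp
  | succ T ih =>
    rw [Finset.sum_Icc_succ_top (Nat.le_add_left 1 T)]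
    have h1 : 0 < √((T + 1 : ℕ) : ℝ) := Real.sqrt_pos.2 (by positivity)
    have h2 : √((T + 1 : ℕ) : ℝ) ^ 2 = T + 1 := by rw [Real.sq_sqrt (by positivity)]; push_cast; rfl
    have h3 : √(T : ℝ) ^ 2 = T := Real.sq_sqrt (by positivity)
    have h4 : 1 / (2 * √((T + 1 : ℕ) : ℝ)) ≤ √((T + 1 : ℕ) : ℝ) - √(T : ℝ) := by
      rw [div_le_iff₀ (by positivity)]
      nlinarith [sq_nonneg (√((T + 1 : ℕ) : ℝ) - √(T : ℝ))]
    linarith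

/-- For T ≥ 2 and λ ≥ 1 one has (λ + T)/λ ≤ T², and constants are absorbed through log T ≥ log 2. -/
theorem exists_sq_G0_le_mul_log (d : ℕ) {lam σ δ : ℝ} (hlam : 1 ≤ lam) (hδ0 : 0 < δ) (hδ1 : δ < 1) :
    ∃ C : ℝ, ∀ T : ℕ, 2 ≤ T → G0 d lam σ δ T ^ 2 ≤ C * Real.log T := by
  have hl : 0 < lam := by linarith
  set D := (max d 2 : ℕ) * Real.log (1 / δ) with hD
  have hD0 : 0 ≤ D := by
    have : 0 ≤ Real.log (1 / δ) := Real.log_nonneg (by rw [le_div_iff₀ hδ0]; linarith)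
    positivity
  refine ⟨2 * σ ^ 2 * (2 * d + D / Real.log 2) + 2 * lam / Real.log 2, fun T hT => ?_⟩
  have hT' : (2 : ℝ) ≤ T := by exact_mod_cast hT
  have h2 := Real.log_pos one_lt_two
  have hlog : Real.log 2 ≤ Real.log T := Real.log_le_log two_pos hT'
  have h0 : 0 ≤ Real.log ((lam + T) / lam) := by
    refine Real.log_nonneg ?_
    rw [one_le_div hl]
    linarith
  have h1 : Real.log ((lam + T) / lam) ≤ 2 * Real.log T := by
    have : Real.log ((lam + T) / lam) ≤ Real.log ((T : ℝ) ^ 2) := by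
      refine Real.log_le_log (by positivity) ?_
      rw [div_le_iff₀ hl]
      have e1 : 0 ≤ (T : ℝ) * (T - 2) * lam := by
        have : (0 : ℝ) ≤ T - 2 := by linarith
        positivity
      have e2 : 0 ≤ (T - 1 : ℝ) * (lam - 1) := mul_nonneg (by linarith) (by linarith)
      nlinarith
    rwa [Real.log_pow] at this
  have hconst : ∀ c : ℝ, 0 ≤ c → c ≤ c / Real.log 2 * Real.log T := by
    intro c hc
    rw [div_mul_eq_mul_div, le_div_iff₀ h2]
    gcongr
  calc G0 d lam σ δ T ^ 2
      ≤ 2 * ((σ * √(d * Real.log ((lam + T) / lam) + D)) ^ 2 + √lam ^ 2) := add_sq_le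
    _ = 2 * σ ^ 2 * (d * Real.log ((lam + T) / lam) + D) + 2 * lam := by
        rw [mul_pow, Real.sq_sqrt (by positivity), Real.sq_sqrt hl.le]
        ring
    _ ≤ 2 * σ ^ 2 * (d * (2 * Real.log T) + D / Real.log 2 * Real.log T) +
          2 * lam / Real.log 2 * Real.log T := by
        refine add_le_add ?_ (hconst (2 * lam) (by positivity))
        gcongr
        exact hconst D hD0
    _ = _ := by ring

theorem exists_sq_G1_le_mul_log {d : ℕ} (hd : 1 ≤ d) {lam : ℝ} (hlam : 1 ≤ lam) :
    ∃ C : ℝ, ∀ T : ℕ, 2 ≤ T → G1 d lam T ^ 2 ≤ C * Real.log T := by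
  have hd0 : (0 : ℝ) < d := by exact_mod_cast hd
  have hd1 : (1 : ℝ) ≤ d := by exact_mod_cast hd
  refine ⟨2 * d * (Real.log (lam + 1) / Real.log 2 + 1), fun T hT => ?_⟩
  have hT' : (2 : ℝ) ≤ T := by exact_mod_cast hT
  have h2 := Real.log_pos one_lt_two
  have hlog : Real.log 2 ≤ Real.log T := Real.log_le_log two_pos hT'
  have hc : 0 ≤ Real.log (lam + 1) := Real.log_nonneg (by linarith)
  have h0 : 0 ≤ Real.log ((d * lam + T) / d) := by
    refine Real.log_nonneg ?_
    rw [one_le_div hd0]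
    nlinarith
  have h1 : Real.log ((d * lam + T) / d) ≤ Real.log (lam + 1) + Real.log T := by
    rw [← Real.log_mul (by positivity) (by positivity)]
    refine Real.log_le_log (by positivity) ?_
    rw [div_le_iff₀ hd0]
    have := mul_le_mul_of_nonneg_left hd1 (by linarith : (0 : ℝ) ≤ T)
    have := mul_nonneg (mul_nonneg hd0.le (by linarith : 0 ≤ lam)) (by linarith : (0 : ℝ) ≤ T - 1)
    nlinarith
  rw [G1, Real.sq_sqrt (by positivity), mul_assoc (2 * (d : ℝ))]
  gcongr
  refine h1.trans ?_
  rw [add_mul, one_mul]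
  gcongr
  rw [div_mul_eq_mul_div, le_div_iff₀ h2]
  gcongr

theorem exists_regretBound_sqrt_le {d : ℕ} (hd : 1 ≤ d) {lam σ δ : ℝ} (hlam : 1 ≤ lam)
    (hδ0 : 0 < δ) (hδ1 : δ < 1) :
    ∃ C : ℝ, ∀ T : ℕ, 2 ≤ T →
      regretBound (fun t => √t) (G0 d lam σ δ T) (G1 d lam T) T ≤ C * (√T * Real.log T) := by
  obtain ⟨A, hA⟩ := exists_sq_G0_le_mul_log d (σ := σ) hlam hδ0 hδ1
  obtain ⟨C, hC⟩ := exists_sq_G1_le_mul_log hd hlam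
  -- The first term contributes G₀², the cross term (G₀² + G₁²)/2 by AM-GM, and the bias term G₁²/2,
  -- each times √T.
  refine ⟨3 / 2 * A + C, fun T hT => ?_⟩
  have h0 := hA T hT
  have h1 := hC T hT
  have hs := sum_one_div_two_mul_sqrt_le T
  rw [regretBound]
  calc _ ≤ G0 d lam σ δ T ^ 2 * √T + √T * ((G0 d lam σ δ T ^ 2 + G1 d lam T ^ 2) / 2) +
        1 / 2 * √T * G1 d lam T ^ 2 := by
        rw [mul_assoc (√(T : ℝ))]
        gcongr
        nlinarith [sq_nonneg (G0 d lam σ δ T - G1 d lam T)]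
    _ = √T * (3 / 2 * G0 d lam σ δ T ^ 2 + G1 d lam T ^ 2) := by ring
    _ ≤ √T * (3 / 2 * (A * Real.log T) + C * Real.log T) := by gcongr
    _ = _ := by ring

end

theorem theorem1 (d : ℕ) (hd : 1 ≤ d) (lam : ℝ) (hlam : 1 ≤ lam) (σ : ℝ) (hσ : 0 < σ)
    (δ : ℝ) (hδ0 : 0 < δ) (hδ1 : δ < 1) :
    (∀ α : ℕ → ℝ, (∀ t, 1 ≤ t → 0 < α t) → MonotoneOn α (Set.Ici 1) →
      ∀ (K : ℕ) (Ω : Type*) [MeasurableSpace Ω] (P : Measure Ω) [IsProbabilityMeasure P]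
        (θ : EuclideanSpace ℝ (Fin d)) (B : BanditRun d K Ω),
        B.IsStandardLinear P θ σ → B.FollowsLinRBMLE lam α →
        1 - δ ≤ P.real {ω | ∀ T : ℕ, 1 ≤ T →
          B.regret θ T ω ≤ regretBound α (G0 d lam σ δ T) (G1 d lam T) T ∧
          (3 * d ≤ T →
            B.regret θ T ω ≤ regretBound α (G0 d lam σ δ T) (G1' d lam T) T)}) ∧
    (∃ C : ℝ,
      ∀ (K : ℕ) (Ω : Type*) [MeasurableSpace Ω] (P : Measure Ω) [IsProbabilityMeasure P]
        (θ : EuclideanSpace ℝ (Fin d)) (B : BanditRun d K Ω),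
        B.IsStandardLinear P θ σ → B.FollowsLinRBMLE lam (fun t => Real.sqrt t) →
        1 - δ ≤ P.real {ω | ∀ T : ℕ, 2 ≤ T →
          B.regret θ T ω ≤ C * (Real.sqrt T * Real.log T)}) := by
  refine ⟨fun α hα hmono K Ω _ P _ θ B hB hact =>
    hB.one_sub_le_measureReal_regret_le hd hlam hσ hδ0 hδ1 hα hmono hact, ?_⟩
  obtain ⟨C, hC⟩ := exists_regretBound_sqrt_le (σ := σ) hd hlam hδ0 hδ1
  refine ⟨C, fun K Ω _ P _ θ B hB hact => ?_⟩
  refine (hB.one_sub_le_measureReal_regret_le hd hlam hσ hδ0 hδ1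
    (fun t ht => Real.sqrt_pos.2 (by exact_mod_cast ht))
    (fun s _ t _ hst => Real.sqrt_le_sqrt (by exact_mod_cast hst)) hact).trans ?_
  exact measureReal_mono fun ω hω T hT => (hω T (by omega)).1.trans (hC T hT)
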